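/- Let $\mathcal S$ be the set of sequences $s_1\ge s_2\ge\dots\ge 0$ with finite sum, $\mathcal S_1=\{\mathbf s\in\mathcal S:\sum_i s_i=1\}$, $\mathbf 1=(1,0,0,\dots)$ and $\mathbf 0=(0,0,\dots)$. Let $\alpha<0$ and let $\nu$ be a probability measure on $\mathcal S_1$ with $\nu(\{\mathbf 1\})=0$. Let $(F(t))_{t\ge 0}$ be the self-similar fragmentation process with parameters $(\alpha,\nu)$ started from a single block of mass $1$: blocks evolve independently, and a block of mass $m$ splits after an exponential time of mean $m^{-\alpha}$ into sub-blocks of masses $m\mathbf S$, where $\mathbf S$ has law $\nu$; $F(t)\in\mathcal S$ is the decreasing sequence of the masses of the blocks present at time $t$. Let $\zeta=\inf\{t\ge0:F(t)=\mathbf 0\}$ be the extinction time and $F_\zeta(x)=\mathbb P(\zeta\le x)$. Almost surely, for every $t<\zeta$ there is a unique block present at time $t$ whose descendants become extinct exactly at time $\zeta$; let $F_*(t)$ be its mass, and $F_*(t)=0$ for $t\ge\zeta$. Put $T_0=0$ and $T_{n}=\inf\{t\ge T_{n-1}:F_*(t)<F_*(T_{n-1})\}$ for $n\ge1$. Let $Z_n=F_*(T_n)^\alpha(\zeta-T_n)$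 for $n\ge 0$, let $\Theta_0=1$, $\mathbf\Delta_0=\mathbf 0$, and for $n\ge1$ let $\Theta_n=F_*(T_n)/F_*(T_{n-1})$ and let $\mathbf\Delta_n=(\Delta_{n,1}\ge\Delta_{n,2}\ge\dots)$ be the sizes, relative to $F_*(T_{n-1})$, of the other sub-blocks produced by the split of the last fragment at time $T_n$. Then $\zeta$ has a density $f_\zeta$ that is continuous and strictly positive on $(0,\infty)$, and the following hold. (a) The process $(Z_n,\Theta_n,\mathbf\Delta_n)_{n\ge0}$ is a time-homogeneous Markov chain. Moreover, conditionally on $\sigma(Z_m,\Theta_m,\mathbf\Delta_m;\,m\le n)$, the law of $(Z_{n+1},\Theta_{n+1},\mathbf\Delta_{n+1})$ depends only on the value of $Z_n$. (b) $(Z_n)_{n\ge0}$ is a time-homogeneous Markov chain with values in $(0,\infty)$ almost surely, and its transition probabilities $P(x,\mathrm dy)$, $x>0$, are given by $$P(x,\mathrm dy)=\frac{e^{-x}}{f_\zeta(x)}\,f_\zeta(y)\left(\int_{\mathcal S_1}\sum_{i:s_i>0}e^{s_i^{-\alpha}y}\prod_{j\ne i}F_\zeta\big(s_j^{\alpha}s_i^{-\alpha}y\big)\mathbf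 1_{\{0<y<s_i^{\alpha}x\}}\,\nu(\mathrm d\mathbf s)\right)\mathrm dy,$$ where a factor with $s_j=0$ is read as $F_\zeta(\infty)=1$. -/

import Mathlib

open MeasureTheory ProbabilityTheory
open scoped ENNReal

noncomputable section

namespace Fragmentation

/-- The set `𝒮₁` of decreasing sequences of nonnegative reals with sum `1`; the index starts at `0`,
so that `s 0` is the largest mass. As a subtype of `ℕ → ℝ` it carries the trace of the product
`σ`-field, which is the Borel `σ`-field of the `ℓ¹`-distance. -/
def massPartitions : Set (ℕ → ℝ) :=
  {s | Antitone s ∧ (∀ i, 0 ≤ s i) ∧ HasSum s 1}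

/-- The marks of the blocks. Blocks are labelled by finite sequences of natural numbers, written
with the most recent generation at the head: `[]` is the initial block and `i :: u` is the `i`-th
sub-block produced by the split of the block `u`. The mark of `u` is the pair of its (unit mean)
exponential clock and of the relative masses of its sub-blocks. -/
abbrev Marks : Type := List ℕ → ℝ × massPartitions

/-- The mass of a block. -/
def mass (ξ : Marks) : List ℕ → ℝ
  | [] => 1
  | i :: u => mass ξ u * ((ξ u).2 : ℕ → ℝ) i

/-- The time of birth of a block: the initial block is born at time `0`, and `i :: u` is born when
`u` splits, that is, `mass u ^ (-α)` times the clock of `u` after the birth of `u`. -/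
def birth (α : ℝ) (ξ : Marks) : List ℕ → ℝ
  | [] => 0
  | _ :: u => birth α ξ u + mass ξ u ^ (-α) * (ξ u).1

/-- The time at which a block splits. -/
def splitTime (α : ℝ) (ξ : Marks) (u : List ℕ) : ℝ :=
  birth α ξ u + mass ξ u ^ (-α) * (ξ u).1

/-- The block `u` is present at time `t`. (For `α < 0`, a label of mass `0` is never present.) -/
def Present (α : ℝ) (ξ : Marks) (u : List ℕ) (t : ℝ) : Prop :=
  birth α ξ u ≤ t ∧ t < splitTime α ξ u

/-- The decreasing rearrangement of a summable family of nonnegative reals (padded by zeros):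
its `n`-th term is the largest `x` such that at least `n + 1` members of the family are `≥ x`. -/
def decreasingRearrangement {ι : Type*} (a : ι → ℝ) (n : ℕ) : ℝ :=
  sSup {x : ℝ | ((n + 1 : ℕ) : ℕ∞) ≤ {i | x ≤ a i}.encard}

open Classical in
/-- The state at time `t` of the fragmentation issued from the block `u`: the decreasing sequence
of the masses of the descendants of `u` (including `u`) that are present at time `t`. -/
def fragmentsOf (α : ℝ) (ξ : Marks) (u : List ℕ) (t : ℝ) : ℕ → ℝ :=
  decreasingRearrangement fun v : List ℕ => if u <:+ v ∧ Present α ξ v t then mass ξ v else 0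

/-- The fragmentation process `F`, started from a single block of mass `1`. -/
def fragmentation (α : ℝ) (ξ : Marks) (t : ℝ) : ℕ → ℝ := fragmentsOf α ξ [] t

/-- The extinction time `ζ` of the fragmentation. (It is almost surely finite.) -/
def extinctionTime (α : ℝ) (ξ : Marks) : ℝ :=
  sInf {t | 0 ≤ t ∧ fragmentation α ξ t = 0}

/-- For a block `u` present at time `t`, the time that it takes, from time `t` on, until all the
mass of `u` is reduced to dust. -/
def residualExtinctionTime (α : ℝ) (ξ : Marks) (u : List ℕ) (t : ℝ) : ℝ :=
  sInf {s | 0 ≤ s ∧ fragmentsOf α ξ u (t + s) = 0}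

/-- Among the blocks present at time `t`, the block `u` takes the longest to become extinct. -/
def IsLastBlock (α : ℝ) (ξ : Marks) (t : ℝ) (u : List ℕ) : Prop :=
  Present α ξ u t ∧
    ∀ v, Present α ξ v t → residualExtinctionTime α ξ v t ≤ residualExtinctionTime α ξ u t

/-- The event that at each time before extinction there is exactly one last block. -/
def HasLastFragment (α : ℝ) (ξ : Marks) : Prop :=
  ∀ t, 0 ≤ t → t < extinctionTime α ξ → ∃! u, IsLastBlock α ξ t u

open Classical in
/-- The label of the last block at time `t` (a junk value if there is none). -/
def lastBlock (α : ℝ) (ξ : Marks) (t : ℝ) : List ℕ :=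
  if h : ∃ u, IsLastBlock α ξ t u then h.choose else []

open Classical in
/-- The last fragment process `F_*`. -/
def lastFragment (α : ℝ) (ξ : Marks) (t : ℝ) : ℝ :=
  if HasLastFragment α ξ ∧ t < extinctionTime α ξ then mass ξ (lastBlock α ξ t) else 0

/-- The jump times of the last fragment process, `T 0 = 0`. -/
def jumpTime (α : ℝ) (ξ : Marks) : ℕ → ℝ
  | 0 => 0
  | n + 1 => sInf {t | jumpTime α ξ n ≤ t ∧
      lastFragment α ξ t < lastFragment α ξ (jumpTime α ξ n)}

/-- `Z n = F_*(T n) ^ α * (ζ - T n)`. -/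
def Z (α : ℝ) (ξ : Marks) (n : ℕ) : ℝ :=
  lastFragment α ξ (jumpTime α ξ n) ^ α * (extinctionTime α ξ - jumpTime α ξ n)

/-- `Θ 0 = 1` and `Θ (n + 1) = F_*(T (n + 1)) / F_*(T n)`. -/
def Θ (α : ℝ) (ξ : Marks) : ℕ → ℝ
  | 0 => 1
  | n + 1 => lastFragment α ξ (jumpTime α ξ (n + 1)) / lastFragment α ξ (jumpTime α ξ n)

/-- The sequence `a` with its `i`-th term removed (it is decreasing if `a` is). -/
def removeTerm (a : ℕ → ℝ) (i j : ℕ) : ℝ := if j < i then a j else a (j + 1)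

/-- `Δ 0 = 0`; `Δ (n + 1)` is the decreasing sequence of the masses, relative to `F_*(T n)`, of the
sub-blocks into which the last block splits at time `T (n + 1)`, without the sub-block that is the
new last block. The sub-blocks of `u` are the `k :: u`, in decreasing order of their masses, and
the rank of the new last block among them is the head of its label. -/
def Δ (α : ℝ) (ξ : Marks) : ℕ → ℕ → ℝ
  | 0 => 0
  | n + 1 => removeTerm
      (fun k => mass ξ (k :: lastBlock α ξ (jumpTime α ξ n)) /
        lastFragment α ξ (jumpTime α ξ n))
      (lastBlock α ξ (jumpTime α ξ (n + 1))).headI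

/-- The triple `(Z n, Θ n, Δ n)`. -/
def chain (α : ℝ) (ξ : Marks) (n : ℕ) : ℝ × ℝ × (ℕ → ℝ) := (Z α ξ n, Θ α ξ n, Δ α ξ n)

/-- `X` is a time-homogeneous Markov chain with transition kernel `κ`: for each `n`, the
conditional law of `X (n + 1)` given `(X 0, …, X n)` is `κ (X n)`. -/
def IsMarkovChain {Ω E : Type*} [MeasurableSpace Ω] [MeasurableSpace E]
    (X : ℕ → Ω → E) (κ : Kernel E E) (P : Measure Ω) : Prop :=
  ∀ n : ℕ, HasCondDistrib (X (n + 1)) (fun ω (m : Finset.Iic n) => X m ω)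
    (κ.comap (fun x : Finset.Iic n → E => x ⟨n, Finset.mem_Iic.2 le_rfl⟩)
      (measurable_pi_apply _)) P

open Classical in
/-- The density at `y` of the transition probability from `x` to `dy`, for a function `f` (the
density of `ζ`) and a function `F` (its cumulative distribution function):
`e⁻ˣ / f x * f y * ∫ ∑_{i : s i > 0} exp (s i ^ (-α) * y) * ∏_{j ≠ i} F (s j ^ α * s i ^ (-α) * y)
* 1_{0 < y < s i ^ α * x} ν(ds)`.
For `s j = 0` the argument of `F` is `∞`, and the factor is `F ∞ = 1`. -/
def transitionDensity (α : ℝ) (ν : Measure massPartitions) (f F : ℝ → ℝ) (x y : ℝ) : ℝ≥0∞ :=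
  ENNReal.ofReal (Real.exp (-x) / f x * f y) *
    ∫⁻ s : massPartitions, ∑' i : ℕ,
      (if 0 < s.1 i ∧ 0 < y ∧ y < s.1 i ^ α * x then
        ENNReal.ofReal (Real.exp (s.1 i ^ (-α) * y) *
          ∏' j : ℕ, if j ≠ i ∧ 0 < s.1 j then F (s.1 j ^ α * s.1 i ^ (-α) * y) else 1)
      else 0) ∂ν

end Fragmentation

end

/-! Everything is read off the tree of marks, whose subtrees are copies of the whole tree,
independent for the children of one block. The extinction time solves L = e + R, where e is the
clock of the initial block and R = sup_i s_i^(-α) L_i with independent copies L_i of L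
(`lifetime_eq`). For p = 1 - 1/α the p-th powers of the weights are s_i^(1-α), and their sum has
mean below 1. So L has a finite p-th moment (`lintegral_lifetime_rpow_lt_top`), and the p-th powers
of the rescaled extinction times are almost surely summable over the whole tree
(`ae_tsum_generationSum_lt_top`). Hence the supremum R is attained, and only once because L is
diffuse. Following the maximiser from generation to generation gives the `spine`. Its birth times
increase to the extinction time, so its blocks are exactly the last fragments
(`Good.isLastBlock_iff`), and Z_n is the extinction time of the marks below its n-th block
(`Good.Z_eq`).

As e is exponential and independent of R, L has density f(x) = e^(-x) E[e^R; R < x], and given L = x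
the marks other than e have their law reweighted by e^R 1_{R < x}
(`lintegral_exp_add_eq_tiltKernel`). Continuity of f follows because R has no atom in (0, ∞);
positivity amounts to P(R < x) > 0 for every x > 0 (`measure_residualReal_lt_ne_zero`).

Whether the i-th sub-block is the last one depends on its own marks only through L_i. So given (Z_1,
Θ_1, Δ_1), the marks of the last sub-block are, up to its clock, those of a tree conditioned on L =
Z_1 (`lintegral_firstStep`). Since R = Θ_1^(-α) Z_1, conditioning also on L = x only reweights by a
function of the first step and keeps this property (`lintegral_condKernel_firstStep`); induction
gives the Markov property (`lintegral_history`). The transition density comes from summing over the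
rank i of the last sub-block: the product of distribution functions is the probability that all
other sub-blocks die earlier (`lintegral_winWeight`, `fst_stepKernel`). -/

noncomputable section

namespace Fragmentation

/-! ### The law of the marks, and resampling of parts of the tree. -/

section

/-- The law of the marks: independent pairs of an exponential clock and of a mass partition. -/
def marksLaw (ν : Measure massPartitions) [IsProbabilityMeasure ν] : Measure Marks :=
  Measure.infinitePi fun _ : List ℕ => (expMeasure 1).prod ν

instance : IsProbabilityMeasure (expMeasure 1) := isProbabilityMeasure_expMeasure one_pos

/-- The marks of the descendants of the block `u`. -/
def subtree (u : List ℕ) (ξ : Marks) : Marks := fun v => ξ (v ++ u)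

@[simp] lemma subtree_nil (ξ : Marks) : subtree [] ξ = ξ := by ext1 v; simp [subtree]

lemma subtree_subtree (u v : List ℕ) (ξ : Marks) :
    subtree v (subtree u ξ) = subtree (v ++ u) ξ := by ext1 w; simp [subtree]

lemma subtree_cons (i : ℕ) (u : List ℕ) (ξ : Marks) :
    subtree (i :: u) ξ = subtree [i] (subtree u ξ) := by rw [subtree_subtree]; rfl

@[fun_prop]
lemma measurable_subtree (u : List ℕ) : Measurable (subtree u) := by
  unfold subtree; fun_prop

variable (ν : Measure massPartitions) [IsProbabilityMeasure ν]

instance : IsProbabilityMeasure (marksLaw ν) := by unfold marksLaw; infer_instance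

/-- Reindexing an i.i.d. family along the injection `v ↦ v ++ u` gives an i.i.d. family with the
same law. -/
lemma measurePreserving_subtree (u : List ℕ) :
    MeasurePreserving (subtree u) (marksLaw ν) (marksLaw ν) :=
  ⟨measurable_subtree u,
    Measure.map_infinitePi_infinitePi_of_inj (P := fun _ : List ℕ => (expMeasure 1).prod ν)
      (f := fun v : List ℕ => v ++ u) (List.append_left_injective u)⟩

lemma measurePreserving_root :
    MeasurePreserving (fun ξ : Marks => ξ []) (marksLaw ν) ((expMeasure 1).prod ν) :=
  measurePreserving_eval_infinitePi _ _

-- On a cylinder the constraints inside `A` concern only one of the two independent copies and those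
-- outside `A` only the other, so the probability factorises. This is the source of all the
-- resampling identities.
open Classical in
lemma measurePreserving_piecewise (A : Set (List ℕ)) :
    MeasurePreserving (fun p : Marks × Marks => A.piecewise p.2 p.1)
      ((marksLaw ν).prod (marksLaw ν)) (marksLaw ν) := by
  have hm : Measurable (fun p : Marks × Marks => A.piecewise p.2 p.1) := by
    refine measurable_pi_iff.2 fun v => ?_
    by_cases hv : v ∈ A <;> simp only [Set.piecewise, hv, if_true, if_false] <;> fun_prop
  refine ⟨hm, Measure.eq_infinitePi _ fun s t ht => ?_⟩
  rw [Measure.map_apply hm (MeasurableSet.pi (Finset.countable_toSet s) fun i _ => ht i)]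
  have : (fun p : Marks × Marks => A.piecewise p.2 p.1) ⁻¹' (Set.pi s t) =
      (Set.pi ↑(s.filter (· ∉ A)) t) ×ˢ (Set.pi ↑(s.filter (· ∈ A)) t) := by
    ext p
    simp only [Set.mem_preimage, Set.mem_pi, Set.mem_prod, Finset.coe_filter, Set.mem_ofPred_eq,
      Finset.mem_coe, Set.piecewise]
    constructor
    · intro h
      exact ⟨fun i hi => by simpa [hi.2] using h i hi.1, fun i hi => by simpa [hi.2] using h i hi.1⟩
    · intro h i hi
      by_cases hA : i ∈ A
      · simpa [hA] using h.2 i ⟨hi, hA⟩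
      · simpa [hA] using h.1 i ⟨hi, hA⟩
  rw [this, Measure.prod_prod, marksLaw, Measure.infinitePi_pi _ (fun i _ => ht i),
    Measure.infinitePi_pi _ (fun i _ => ht i), mul_comm,
    Finset.prod_filter_mul_prod_filter_not]

open Classical in
lemma lintegral_eq_lintegral_piecewise (A : Set (List ℕ)) {φ : Marks → ℝ≥0∞} (hφ : Measurable φ) :
    ∫⁻ ξ, φ ξ ∂marksLaw ν = ∫⁻ ξ, ∫⁻ η, φ (A.piecewise η ξ) ∂marksLaw ν ∂marksLaw ν := by
  rw [← (measurePreserving_piecewise ν A).lintegral_comp hφ, lintegral_prod]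
  exact (hφ.comp (measurePreserving_piecewise ν A).measurable).aemeasurable

/-- Resampling of the descendants of the `i`-th sub-block of the initial block. -/
lemma lintegral_resample_subtree (i : ℕ) {φ : Marks → Marks → ℝ≥0∞}
    (hφ : Measurable (Function.uncurry φ))
    (hdep : ∀ ξ ξ' η, (∀ v, ¬ [i] <:+ v → ξ v = ξ' v) → φ ξ η = φ ξ' η) :
    ∫⁻ ξ, φ ξ (subtree [i] ξ) ∂marksLaw ν = ∫⁻ ξ, ∫⁻ η, φ ξ η ∂marksLaw ν ∂marksLaw ν := by
  classical
  rw [lintegral_eq_lintegral_piecewise ν {v | [i] <:+ v}]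
  · refine lintegral_congr fun ξ => ?_
    rw [← (measurePreserving_subtree ν [i]).lintegral_comp (f := fun η => φ ξ η)
      (hφ.comp (by fun_prop : Measurable fun η : Marks => (ξ, η)))]
    refine lintegral_congr fun η => ?_
    refine (congrArg _ ?_).trans (hdep _ _ _ fun v hv => by simp [hv])
    ext1 v; simp [subtree]
  · exact hφ.comp (by fun_prop : Measurable fun ξ : Marks => (ξ, subtree [i] ξ))

/-- Resampling of the mark of the initial block. -/
lemma lintegral_resample_root {φ : Marks → ℝ≥0∞} (hφ : Measurable φ) :
    ∫⁻ ξ, φ ξ ∂marksLaw ν =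
      ∫⁻ ξ, ∫⁻ a, φ (Function.update ξ [] a) ∂((expMeasure 1).prod ν) ∂marksLaw ν := by
  classical
  rw [lintegral_eq_lintegral_piecewise ν {[]} hφ]
  refine lintegral_congr fun ξ => ?_
  rw [← (measurePreserving_root ν).lintegral_comp (f := fun a => φ (Function.update ξ [] a))
    (hφ.comp (measurable_update ξ))]
  refine lintegral_congr fun η => ?_
  rw [Set.piecewise_singleton]

/-- Replace the clock of the initial block. -/
def setClock (e : ℝ) (ξ : Marks) : Marks := Function.update ξ [] (e, (ξ []).2)

lemma setClock_update (e : ℝ) (ξ : Marks) (a : ℝ × massPartitions) :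
    setClock e (Function.update ξ [] a) = Function.update ξ [] (e, a.2) := by
  simp [setClock]

@[simp] lemma setClock_root (e : ℝ) (ξ : Marks) : setClock e ξ [] = (e, (ξ []).2) := by
  simp [setClock]

lemma setClock_of_ne (e : ℝ) (ξ : Marks) {v : List ℕ} (hv : v ≠ []) : setClock e ξ v = ξ v := by
  simp [setClock, hv]

@[simp] lemma subtree_setClock (e : ℝ) (ξ : Marks) (i : ℕ) (u : List ℕ) :
    subtree (i :: u) (setClock e ξ) = subtree (i :: u) ξ := by
  ext1 v; simp [subtree, setClock_of_ne]

@[fun_prop]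
lemma measurable_setClock : Measurable fun p : ℝ × Marks => setClock p.1 p.2 := by
  refine measurable_pi_iff.2 fun v => ?_
  by_cases hv : v = []
  · subst hv; simp only [setClock_root]; fun_prop
  · simp only [setClock_of_ne _ _ hv]; fun_prop

@[simp] lemma setClock_setClock (e e' : ℝ) (ξ : Marks) :
    setClock e (setClock e' ξ) = setClock e ξ := by
  simp [setClock]

/-- The clock of the initial block is independent of all the other marks. -/
lemma lintegral_resample_clock {φ : ℝ → Marks → ℝ≥0∞} (hφ : Measurable (Function.uncurry φ)) :
    ∫⁻ ξ, φ (ξ []).1 (setClock 0 ξ) ∂marksLaw ν =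
      ∫⁻ ξ, ∫⁻ e, φ e (setClock 0 ξ) ∂expMeasure 1 ∂marksLaw ν := by
  have h1 : Measurable fun ξ : Marks => φ (ξ []).1 (setClock 0 ξ) :=
    hφ.comp (by fun_prop : Measurable fun ξ : Marks => ((ξ []).1, setClock 0 ξ))
  have h2 : Measurable fun ξ : Marks => ∫⁻ e, φ e (setClock 0 ξ) ∂expMeasure 1 := by
    refine Measurable.lintegral_prod_right' (f := fun p : Marks × ℝ => φ p.2 (setClock 0 p.1)) ?_
    exact hφ.comp (by fun_prop : Measurable fun p : Marks × ℝ => (p.2, setClock 0 p.1))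
  rw [lintegral_resample_root ν h1, lintegral_resample_root ν h2]
  refine lintegral_congr fun ξ => ?_
  simp only [setClock_update, Function.update_self]
  have hu : Measurable fun a : ℝ × massPartitions =>
      Function.update ξ ([] : List ℕ) ((0 : ℝ), a.2) :=
    (measurable_update ξ).comp (by fun_prop)
  have hφu : Measurable fun a : ℝ × massPartitions =>
      φ a.1 (Function.update ξ ([] : List ℕ) ((0 : ℝ), a.2)) := hφ.comp (measurable_fst.prodMk hu)
  rw [lintegral_prod_symm _ hφu.aemeasurable, lintegral_prod_symm _ ?_]
  · simp
  · have : Measurable fun p : (ℝ × massPartitions) × ℝ =>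
      φ p.2 (Function.update ξ ([] : List ℕ) ((0 : ℝ), p.1.2)) :=
      hφ.comp (measurable_snd.prodMk (hu.comp measurable_fst))
    exact this.lintegral_prod_right'.aemeasurable

/-- Given the mark of the initial block, the marks of the descendants of its sub-blocks are
independent. -/
lemma lintegral_prod_subtree (J : Finset ℕ) {h : ℝ × massPartitions → ℝ≥0∞} (hh : Measurable h)
    {g : ℕ → ℝ × massPartitions → Marks → ℝ≥0∞} (hg : ∀ j, Measurable (Function.uncurry (g j))) :
    ∫⁻ ξ, h (ξ []) * ∏ j ∈ J, g j (ξ []) (subtree [j] ξ) ∂marksLaw ν =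
      ∫⁻ a, h a * ∏ j ∈ J, ∫⁻ η, g j a η ∂marksLaw ν ∂((expMeasure 1).prod ν) := by
  classical
  induction J using Finset.induction_on generalizing h with
  | empty => simp [← (measurePreserving_root ν).lintegral_comp hh]
  | insert i J hi ih =>
    have hgi : Measurable fun a => ∫⁻ η, g i a η ∂marksLaw ν := (hg i).lintegral_prod_right'
    have hm (j : ℕ) : Measurable fun ξ : Marks => g j (ξ []) (subtree [j] ξ) :=
      (hg j).comp (by fun_prop : Measurable fun ξ : Marks => (ξ [], subtree [j] ξ))
    have key := lintegral_resample_subtree ν i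
      (φ := fun ξ η => (h (ξ []) * ∏ j ∈ J, g j (ξ []) (subtree [j] ξ)) * g i (ξ []) η) ?_ ?_
    · calc _ = ∫⁻ ξ, (h (ξ []) * ∏ j ∈ J, g j (ξ []) (subtree [j] ξ)) *
            g i (ξ []) (subtree [i] ξ) ∂marksLaw ν := by
            refine lintegral_congr fun ξ => ?_
            rw [Finset.prod_insert hi]; ring
        _ = ∫⁻ ξ, (h (ξ []) * ∫⁻ η, g i (ξ []) η ∂marksLaw ν) *
            ∏ j ∈ J, g j (ξ []) (subtree [j] ξ) ∂marksLaw ν := by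
            rw [key]
            refine lintegral_congr fun ξ => ?_
            rw [lintegral_const_mul]
            · ring
            · exact (hg i).comp (by fun_prop : Measurable fun η : Marks => (ξ [], η))
        _ = _ := by
            rw [ih (h := fun a => h a * ∫⁻ η, g i a η ∂marksLaw ν) (hh.mul hgi)]
            refine lintegral_congr fun a => ?_
            rw [Finset.prod_insert hi]; ring
    · refine Measurable.mul (Measurable.mul (hh.comp (by fun_prop)) ?_) ?_
      · exact Finset.measurable_fun_prod _ fun j _ => (hm j).comp measurable_fst
      · exact (hg i).comp (by fun_prop : Measurable fun p : Marks × Marks => (p.1 [], p.2))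
    · intro ξ ξ' η hξ
      have h0 : ξ [] = ξ' [] := hξ _ (by simp)
      simp only [h0]
      congr 2
      refine Finset.prod_congr rfl fun j hj => ?_
      have : subtree [j] ξ = subtree [j] ξ' := by
        ext1 v
        refine hξ _ fun hs => hi ?_
        obtain ⟨w, hw⟩ := hs
        have := List.append_inj_right' hw rfl
        simp only [List.cons.injEq, and_true] at this
        rwa [this]
      rw [this]

end

/-! ### The recursion for the extinction time and its moments. -/

section

lemma lintegral_expMeasure {φ : ℝ → ℝ≥0∞} (hφ : Measurable φ) :
    ∫⁻ e, φ e ∂expMeasure 1 = ∫⁻ e in Set.Ioi 0, ENNReal.ofReal (Real.exp (-e)) * φ e := by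
  have hm : Measurable (exponentialPDF 1) := (measurable_exponentialPDFReal 1).ennreal_ofReal
  change ∫⁻ e, φ e ∂(volume.withDensity (exponentialPDF 1)) = _
  rw [lintegral_withDensity_eq_lintegral_mul _ hm hφ, ← lintegral_indicator measurableSet_Ioi]
  refine lintegral_congr_ae ?_
  filter_upwards [compl_mem_ae_iff.2 (measure_singleton (0 : ℝ))] with e he
  rcases lt_or_gt_of_ne (show e ≠ 0 from he) with h | h
  · simp [exponentialPDF_of_neg h, h.le]
  · simp [exponentialPDF_of_nonneg h.le, h]

lemma ae_pos_expMeasure : ∀ᵐ e ∂expMeasure 1, 0 < e := by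
  rw [ae_iff, ← lintegral_indicator_one (by measurability), lintegral_expMeasure
    (measurable_one.indicator (by measurability)), setLIntegral_eq_zero_iff measurableSet_Ioi]
  · refine Filter.Eventually.of_forall fun e he => ?_
    simp [Set.indicator, Set.mem_Ioi.1 he]
  · exact ((by fun_prop : Measurable fun e : ℝ => ENNReal.ofReal (Real.exp (-e)))).mul
      (measurable_one.indicator (by measurability))

lemma lintegral_rpow_expMeasure_lt_top {p : ℝ} (hp : 0 < p) :
    ∫⁻ e, ENNReal.ofReal e ^ p ∂expMeasure 1 < ∞ := by
  rw [lintegral_expMeasure (by fun_prop)]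
  have := (Real.GammaIntegral_convergent (s := p + 1) (by linarith)).lintegral_lt_top
  refine lt_of_eq_of_lt (setLIntegral_congr_fun measurableSet_Ioi fun e he => ?_) this
  simp only [add_sub_cancel_right]
  rw [ENNReal.ofReal_mul (Real.exp_pos _).le,
    ENNReal.ofReal_rpow_of_nonneg (le_of_lt he) hp.le]

/-- The relative mass of the `i`-th sub-block of the initial block. -/
def part (ξ : Marks) (i : ℕ) : ℝ := ((ξ []).2 : ℕ → ℝ) i

lemma part_nonneg (ξ : Marks) (i : ℕ) : 0 ≤ part ξ i := (ξ []).2.2.2.1 i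

@[fun_prop]
lemma measurable_massPartitions_apply (i : ℕ) :
    Measurable fun s : massPartitions => (s : ℕ → ℝ) i :=
  (measurable_pi_apply i).comp measurable_subtype_coe

lemma measurable_ofReal_apply_rpow (i : ℕ) (c : ℝ) :
    Measurable fun s : massPartitions => ENNReal.ofReal ((s : ℕ → ℝ) i ^ c) :=
  ((measurable_massPartitions_apply i).pow_const c).ennreal_ofReal

@[fun_prop]
lemma measurable_part (i : ℕ) : Measurable fun ξ => part ξ i :=
  (measurable_massPartitions_apply i).comp (measurable_snd.comp (measurable_pi_apply []))

variable (α : ℝ)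

/-- The time until extinction when the blocks of generation `n` are discarded. -/
def truncatedLifetime : ℕ → Marks → ℝ≥0∞
  | 0, _ => 0
  | n + 1, ξ => ENNReal.ofReal (ξ []).1 +
      ⨆ i, ENNReal.ofReal (part ξ i ^ (-α)) * truncatedLifetime n (subtree [i] ξ)

/-- The time until extinction, as an extended real. -/
def lifetime (ξ : Marks) : ℝ≥0∞ := ⨆ n, truncatedLifetime α n ξ

/-- The time between the split of the initial block and extinction. -/
def residualLifetime (ξ : Marks) : ℝ≥0∞ :=
  ⨆ i, ENNReal.ofReal (part ξ i ^ (-α)) * lifetime α (subtree [i] ξ)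

@[fun_prop]
lemma measurable_truncatedLifetime (n : ℕ) : Measurable (truncatedLifetime α n) := by
  induction n with
  | zero => exact measurable_const
  | succ n ih =>
    change Measurable fun ξ : Marks => ENNReal.ofReal (ξ []).1 + ⨆ i,
      ENNReal.ofReal (part ξ i ^ (-α)) * truncatedLifetime α n (subtree [i] ξ)
    fun_prop

@[fun_prop]
lemma measurable_lifetime : Measurable (lifetime α) := by
  unfold lifetime; fun_prop

@[fun_prop]
lemma measurable_residualLifetime : Measurable (residualLifetime α) := by
  unfold residualLifetime; fun_prop

lemma monotone_truncatedLifetime : Monotone (truncatedLifetime α) := by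
  refine monotone_nat_of_le_succ fun n => ?_
  induction n with
  | zero => exact fun _ => zero_le
  | succ n ih =>
    intro ξ
    change ENNReal.ofReal _ + _ ≤ ENNReal.ofReal _ + _
    gcongr with i
    exact ih _

/-- The truncations increase with `n`, so their limit commutes with the supremum over the
sub-blocks, and the recursion passes to the limit. -/
lemma lifetime_eq (ξ : Marks) :
    lifetime α ξ = ENNReal.ofReal (ξ []).1 + residualLifetime α ξ := by
  have h : lifetime α ξ = ⨆ n, truncatedLifetime α (n + 1) ξ :=
    (Monotone.iSup_nat_add (f := fun n => truncatedLifetime α n ξ)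
      (fun _ _ hmn => monotone_truncatedLifetime α hmn ξ) 1).symm
  rw [h]
  simp only [truncatedLifetime, residualLifetime, lifetime, ENNReal.mul_iSup]
  rw [← ENNReal.add_iSup, iSup_comm]

variable {α}

/-- This fixes the exponent p = 1 - 1/α: from (-α) p = 1 - α, the p-th power of a time scale is a
mass to a power larger than 1, hence summable over the sub-blocks. -/
lemma ofReal_rpow_neg_rpow (hα : α < 0) {x : ℝ} (hx : 0 ≤ x) :
    ENNReal.ofReal (x ^ (-α)) ^ (1 - α⁻¹) = ENNReal.ofReal (x ^ (1 - α)) := by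
  have h1 : 0 < 1 - α⁻¹ := by have := inv_lt_zero.2 hα; linarith
  rw [ENNReal.ofReal_rpow_of_nonneg (by positivity) h1.le, ← Real.rpow_mul hx]
  congr 2
  have := mul_inv_cancel₀ hα.ne
  linarith

lemma ae_lt_one {ν : Measure massPartitions}
    (hν : ν {s | (s : ℕ → ℝ) = Pi.single 0 1} = 0) :
    ∀ᵐ s : massPartitions ∂ν, (s : ℕ → ℝ) 0 < 1 := by
  have : ∀ᵐ s : massPartitions ∂ν, ¬ (s : ℕ → ℝ) = Pi.single 0 1 := by
    rw [ae_iff]; simpa using hν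
  filter_upwards [this] with s hs
  refine lt_of_le_of_ne (le_hasSum s.2.2.2 0 fun j _ => s.2.2.1 j) fun h => hs ?_
  have hz : HasSum (fun i => (s : ℕ → ℝ) i - Pi.single (M := fun _ => ℝ) 0 1 i) 0 := by
    have := s.2.2.2.sub (hasSum_pi_single (0 : ℕ) (1 : ℝ)); simpa using this
  have hnn : ∀ i, 0 ≤ (s : ℕ → ℝ) i - Pi.single (M := fun _ => ℝ) 0 1 i := by
    intro i
    rcases Nat.eq_zero_or_pos i with rfl | hi
    · simp [h]
    · simpa [Pi.single_apply, hi.ne'] using s.2.2.1 i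
  ext i
  have := (hasSum_zero_iff_of_nonneg hnn).1 hz
  have := congrFun this i
  simpa [sub_eq_zero] using this

variable (α) (ν : Measure massPartitions) [IsProbabilityMeasure ν]

/-- The mean of `∑ i, s i ^ (1 - α)` for the dislocation law `ν`. -/
def powerSum : ℝ≥0∞ := ∫⁻ s : massPartitions, ∑' i, ENNReal.ofReal ((s : ℕ → ℝ) i ^ (1 - α)) ∂ν

lemma lintegral_tsum_part_mul {φ : Marks → ℝ≥0∞} (hφ : Measurable φ) :
    ∫⁻ ξ, ∑' i, ENNReal.ofReal (part ξ i ^ (1 - α)) * φ (subtree [i] ξ) ∂marksLaw ν =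
      powerSum α ν * ∫⁻ ξ, φ ξ ∂marksLaw ν := by
  rw [lintegral_tsum (fun i => by fun_prop), powerSum,
    lintegral_tsum (fun i => (measurable_ofReal_apply_rpow i _).aemeasurable),
    ← ENNReal.tsum_mul_right]
  refine tsum_congr fun i => ?_
  have hm : Measurable fun a : ℝ × massPartitions =>
    ENNReal.ofReal ((a.2 : ℕ → ℝ) i ^ (1 - α)) :=
    (measurable_ofReal_apply_rpow i _).comp measurable_snd
  have := lintegral_prod_subtree ν {i}
    (h := fun a => ENNReal.ofReal ((a.2 : ℕ → ℝ) i ^ (1 - α))) (g := fun _ _ η => φ η)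
    hm (fun j => by fun_prop)
  simp only [Finset.prod_singleton] at this
  refine this.trans ?_
  rw [lintegral_mul_const _ hm]
  congr 1
  rw [lintegral_prod _ hm.aemeasurable]
  simp

variable {ν}

variable {α}

/-- From s_i^(1-α) ≤ s_0^(-α) s_i and the total mass 1, the sum is at most s_0^(-α), which is below
1 almost surely. -/
lemma powerSum_lt_one (hα : α < 0) (hν : ν {s | (s : ℕ → ℝ) = Pi.single 0 1} = 0) :
    powerSum α ν < 1 := by
  have hle : ∀ s : massPartitions, ∑' i, ENNReal.ofReal ((s : ℕ → ℝ) i ^ (1 - α)) ≤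
      ENNReal.ofReal ((s : ℕ → ℝ) 0 ^ (-α)) := by
    intro s
    calc _ ≤ ∑' i, ENNReal.ofReal ((s : ℕ → ℝ) 0 ^ (-α)) * ENNReal.ofReal ((s : ℕ → ℝ) i) := by
          refine ENNReal.tsum_le_tsum fun i => ?_
          rw [← ENNReal.ofReal_mul (Real.rpow_nonneg (s.2.2.1 0) _)]
          refine ENNReal.ofReal_le_ofReal ?_
          rw [show 1 - α = -α + 1 by ring, Real.rpow_add' (s.2.2.1 i) (by linarith),
            Real.rpow_one]
          exact mul_le_mul_of_nonneg_right
            (Real.rpow_le_rpow (s.2.2.1 i) (s.2.1 (Nat.zero_le i)) (by linarith)) (s.2.2.1 i)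
      _ = _ := by
          rw [ENNReal.tsum_mul_left, ← ENNReal.ofReal_tsum_of_nonneg s.2.2.1 s.2.2.2.summable,
            s.2.2.2.tsum_eq]
          simp
  calc powerSum α ν ≤ ∫⁻ s : massPartitions, ENNReal.ofReal ((s : ℕ → ℝ) 0 ^ (-α)) ∂ν :=
        lintegral_mono hle
    _ < ∫⁻ _ : massPartitions, 1 ∂ν := by
        refine lintegral_strict_mono (IsProbabilityMeasure.ne_zero ν) (by fun_prop)
          ?_ ?_
        · refine ne_top_of_le_ne_top (b := ∫⁻ _ : massPartitions, 1 ∂ν) (by simp)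
            (lintegral_mono fun s => ?_)
          exact ENNReal.ofReal_le_one.2 (Real.rpow_le_one (s.2.2.1 0)
            (le_hasSum s.2.2.2 0 fun j _ => s.2.2.1 j) (by linarith))
        · filter_upwards [ae_lt_one hν] with s hs
          exact ENNReal.ofReal_lt_one.2 (Real.rpow_lt_one (s.2.2.1 0) hs (by linarith))
    _ = 1 := by simp

variable (ν) in
lemma lintegral_root_clock {φ : ℝ → ℝ≥0∞} (hφ : Measurable φ) :
    ∫⁻ ξ, φ (ξ []).1 ∂marksLaw ν = ∫⁻ e, φ e ∂expMeasure 1 := by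
  rw [(measurePreserving_root ν).lintegral_comp (f := fun a => φ a.1) (by fun_prop),
    lintegral_prod _ (by fun_prop)]
  simp

lemma iSup_rpow_le_tsum {ι : Type*} (f : ι → ℝ≥0∞) {p : ℝ} (hp : 0 < p) :
    (⨆ i, f i) ^ p ≤ ∑' i, f i ^ p := by
  rw [← ENNReal.rpow_le_rpow_iff (z := p⁻¹) (by positivity), ENNReal.rpow_rpow_inv hp.ne']
  refine iSup_le fun i => ?_
  rw [ENNReal.le_rpow_inv_iff hp]
  exact ENNReal.le_tsum i

/-- Contraction in L^p. The p-th power of the supremum is at most the sum of the p-th powers, so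
Minkowski's inequality gives ‖L_(n+1)‖ ≤ C + r ‖L_n‖ for the truncated lifetimes, with r < 1;
monotone convergence concludes. -/
lemma lintegral_lifetime_rpow_lt_top (hα : α < 0)
    (hν : ν {s | (s : ℕ → ℝ) = Pi.single 0 1} = 0) :
    ∫⁻ ξ, lifetime α ξ ^ (1 - α⁻¹) ∂marksLaw ν < ∞ := by
  have hp : 1 < 1 - α⁻¹ := by have := inv_lt_zero.2 hα; linarith
  set p := 1 - α⁻¹ with hpdef
  have hp0 : 0 < p := by linarith
  have hρ := powerSum_lt_one (ν := ν) hα hν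
  set r := powerSum α ν ^ (1 / p) with hr
  have hr1 : r < 1 := ENNReal.rpow_lt_one hρ (by positivity)
  set C := (∫⁻ e, ENNReal.ofReal e ^ p ∂expMeasure 1) ^ (1 / p) with hC
  have hCtop : C < ∞ := ENNReal.rpow_lt_top_of_nonneg (by positivity)
    (lintegral_rpow_expMeasure_lt_top hp0).ne
  have hsub : 1 - r ≠ 0 := (tsub_pos_of_lt hr1).ne'
  -- The fixed point of `b ↦ C + r * b`, hence a bound stable under the induction.
  set B := C * (1 - r)⁻¹ with hB
  have hBtop : B < ∞ := ENNReal.mul_lt_top hCtop (ENNReal.inv_lt_top.2 (pos_iff_ne_zero.2 hsub))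
  have hfix : C + r * B = B := by
    have h1 : (1 - r) * B = C := by
      rw [hB, mul_left_comm, ENNReal.mul_inv_cancel hsub
        (ne_top_of_le_ne_top ENNReal.one_ne_top tsub_le_self), mul_one]
    calc C + r * B = ((1 - r) + r) * B := by rw [add_mul, h1]
      _ = B := by rw [tsub_add_cancel_of_le hr1.le, one_mul]
  have key : ∀ n, (∫⁻ ξ, truncatedLifetime α n ξ ^ p ∂marksLaw ν) ^ (1 / p) ≤ B := by
    intro n
    induction n with
    | zero => simp [truncatedLifetime, hp0]
    | succ n ih =>
      have hm : Measurable fun ξ : Marks =>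
        ⨆ i, ENNReal.ofReal (part ξ i ^ (-α)) * truncatedLifetime α n (subtree [i] ξ) := by
        fun_prop
      have hM := ENNReal.lintegral_Lp_add_le (μ := marksLaw ν)
        (f := fun ξ => ENNReal.ofReal (ξ []).1)
        (by fun_prop : Measurable fun ξ : Marks => ENNReal.ofReal (ξ []).1).aemeasurable
        hm.aemeasurable hp.le
      refine hM.trans (le_trans (add_le_add (le_of_eq ?_) ?_) hfix.le)
      · rw [hC, lintegral_root_clock ν (φ := fun e => ENNReal.ofReal e ^ p) (by fun_prop)]
      · refine le_trans ?_ (mul_le_mul_right ih r)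
        rw [hr, ← ENNReal.mul_rpow_of_nonneg _ _ (by positivity)]
        refine ENNReal.rpow_le_rpow ?_ (by positivity)
        rw [← lintegral_tsum_part_mul α ν (φ := fun ξ => truncatedLifetime α n ξ ^ p)
          (by fun_prop)]
        refine lintegral_mono fun ξ => (iSup_rpow_le_tsum _ hp0).trans (le_of_eq ?_)
        refine tsum_congr fun i => ?_
        rw [ENNReal.mul_rpow_of_nonneg _ _ hp0.le, hpdef, ofReal_rpow_neg_rpow hα (part_nonneg ξ i)]
  have hmono : ∀ ξ, lifetime α ξ ^ p = ⨆ n, truncatedLifetime α n ξ ^ p := fun ξ =>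
    (ENNReal.orderIsoRpow p hp0).map_iSup _
  simp_rw [hmono]
  rw [lintegral_iSup (fun n => by fun_prop)
    (fun m n hmn ξ => ENNReal.rpow_le_rpow (monotone_truncatedLifetime α hmn ξ) hp0.le)]
  refine lt_of_le_of_lt (iSup_le fun n => ?_) (ENNReal.rpow_lt_top_of_nonneg hp0.le hBtop.ne)
  rw [← ENNReal.rpow_inv_le_iff hp0, ← one_div]
  exact key n

variable (α) in
/-- The sum over the blocks of generation `n` of the `(1 - α⁻¹)`-th power of the time elapsed
between the birth of the block and the extinction of its descendants. -/
def generationSum : ℕ → Marks → ℝ≥0∞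
  | 0, ξ => lifetime α ξ ^ (1 - α⁻¹)
  | n + 1, ξ => ∑' i, ENNReal.ofReal (part ξ i ^ (1 - α)) * generationSum n (subtree [i] ξ)

variable (α) in
@[fun_prop]
lemma measurable_generationSum (n : ℕ) : Measurable (generationSum α n) := by
  induction n with
  | zero => exact (measurable_lifetime α).pow_const _
  | succ n ih =>
    change Measurable fun ξ : Marks =>
      ∑' i, ENNReal.ofReal (part ξ i ^ (1 - α)) * generationSum α n (subtree [i] ξ)
    exact Measurable.tsum fun i => by fun_prop

lemma lintegral_generationSum (n : ℕ) : ∫⁻ ξ, generationSum α n ξ ∂marksLaw ν =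
    powerSum α ν ^ n * ∫⁻ ξ, lifetime α ξ ^ (1 - α⁻¹) ∂marksLaw ν := by
  induction n with
  | zero => simp [generationSum]
  | succ n ih =>
    change ∫⁻ ξ, ∑' i, ENNReal.ofReal (part ξ i ^ (1 - α)) *
      generationSum α n (subtree [i] ξ) ∂marksLaw ν = _
    rw [lintegral_tsum_part_mul α ν (measurable_generationSum α n), ih, pow_succ]
    ring

/-- The means of the generation sums form a convergent geometric series. This yields both that
suprema are attained and that remaining lifetimes vanish along the spine. -/
lemma ae_tsum_generationSum_lt_top (hα : α < 0)
    (hν : ν {s | (s : ℕ → ℝ) = Pi.single 0 1} = 0) :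
    ∀ᵐ ξ ∂marksLaw ν, ∑' n, generationSum α n ξ < ∞ := by
  refine ae_lt_top (Measurable.tsum fun n => by fun_prop) ?_
  rw [lintegral_tsum (fun n => by fun_prop)]
  simp_rw [lintegral_generationSum, ENNReal.tsum_mul_right, ENNReal.tsum_geometric]
  refine (ENNReal.mul_lt_top (ENNReal.inv_lt_top.2 (tsub_pos_of_lt (powerSum_lt_one hα hν)))
    (lintegral_lifetime_rpow_lt_top hα hν)).ne

lemma ae_lifetime_lt_top (hα : α < 0) (hν : ν {s | (s : ℕ → ℝ) = Pi.single 0 1} = 0) :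
    ∀ᵐ ξ ∂marksLaw ν, lifetime α ξ < ∞ := by
  have hp : 0 < 1 - α⁻¹ := by have := inv_lt_zero.2 hα; linarith
  filter_upwards [ae_lt_top (by fun_prop) (lintegral_lifetime_rpow_lt_top hα hν).ne] with ξ hξ
  by_contra h
  rw [not_lt, top_le_iff] at h
  simp [h, ENNReal.top_rpow_of_pos hp] at hξ

end

/-! ### The sum of an exponential variable and an independent variable. -/

section

section Tilt

variable {E : Type*} [MeasurableSpace E]

/-- `exp (G y)` on the event `G y < x`. -/
def tiltWeight (G : E → ℝ) (x : ℝ) (y : E) : ℝ≥0∞ :=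
  if G y < x then ENNReal.ofReal (Real.exp (G y)) else 0

/-- The integral of `exp G` on the event `G < x`. -/
def tiltMass (m : Measure E) (G : E → ℝ) (x : ℝ) : ℝ≥0∞ := ∫⁻ y, tiltWeight G x y ∂m

/-- The density on `(0, ∞)` of the sum of a standard exponential variable and of an independent
variable `G ≥ 0`. -/
def tiltDensity (m : Measure E) (G : E → ℝ) (x : ℝ) : ℝ := Real.exp (-x) * (tiltMass m G x).toReal

/-- The conditional law of `y` given that `e + G y = x`, where `e` is a standard exponential
variable and `y` has law `m`. For `x ≤ 0` it is `m`. -/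
def tiltKernel (m : Measure E) [SFinite m] (G : E → ℝ) : Kernel ℝ E :=
  (Kernel.const ℝ m).withDensity
    fun x y => if 0 < x then (tiltMass m G x)⁻¹ * tiltWeight G x y else 1

variable {m : Measure E} [IsProbabilityMeasure m] {G : E → ℝ}

lemma measurable_tiltWeight (hG : Measurable G) :
    Measurable (Function.uncurry (tiltWeight G)) :=
  Measurable.ite (measurableSet_lt (hG.comp measurable_snd) measurable_fst)
    (by fun_prop) measurable_const

lemma measurable_tiltMass (hG : Measurable G) : Measurable (tiltMass m G) :=
  (measurable_tiltWeight hG).lintegral_prod_right'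

lemma tiltMass_le (x : ℝ) : tiltMass m G x ≤ ENNReal.ofReal (Real.exp x) := by
  calc tiltMass m G x ≤ ∫⁻ _, ENNReal.ofReal (Real.exp x) ∂m := by
        refine lintegral_mono fun y => ?_
        unfold tiltWeight
        split_ifs with h
        · exact ENNReal.ofReal_le_ofReal (Real.exp_le_exp.2 h.le)
        · exact zero_le
    _ = _ := by simp

lemma ofReal_tiltDensity (x : ℝ) :
    ENNReal.ofReal (tiltDensity m G x) = ENNReal.ofReal (Real.exp (-x)) * tiltMass m G x := by
  rw [tiltDensity, ENNReal.ofReal_mul (Real.exp_pos _).le, ENNReal.ofReal_toReal]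
  exact ne_top_of_le_ne_top ENNReal.ofReal_ne_top (tiltMass_le x)

lemma measurable_tiltKernel_density (hG : Measurable G) : Measurable (Function.uncurry
    fun x y => if 0 < x then (tiltMass m G x)⁻¹ * tiltWeight G x y else 1) :=
  Measurable.ite (measurableSet_lt measurable_const measurable_fst)
    (((measurable_tiltMass hG).comp measurable_fst).inv.mul (measurable_tiltWeight hG))
    measurable_const

lemma lintegral_tiltKernel (hG : Measurable G) {x : ℝ} (hx : 0 < x) {φ : E → ℝ≥0∞}
    (hφ : Measurable φ) :
    ∫⁻ y, φ y ∂tiltKernel m G x = (tiltMass m G x)⁻¹ * ∫⁻ y, tiltWeight G x y * φ y ∂m := by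
  have hw : Measurable (tiltWeight G x) := (measurable_tiltWeight hG).of_uncurry_left
  rw [tiltKernel, Kernel.lintegral_withDensity _ (measurable_tiltKernel_density hG) _ hφ]
  simp only [hx, if_true, Kernel.const_apply]
  simp_rw [mul_assoc]
  exact lintegral_const_mul _ (hw.mul hφ)

lemma tiltKernel_of_nonpos (hG : Measurable G) {x : ℝ} (hx : x ≤ 0) :
    tiltKernel m G x = m := by
  rw [tiltKernel, Kernel.withDensity_apply _ (measurable_tiltKernel_density hG)]
  simp only [hx.not_gt, if_false, Kernel.const_apply]
  exact withDensity_one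

lemma isMarkovKernel_tiltKernel (hG : Measurable G) (hpos : ∀ x, 0 < x → tiltMass m G x ≠ 0) :
    IsMarkovKernel (tiltKernel m G) := by
  refine ⟨fun x => ⟨?_⟩⟩
  rcases le_or_gt x 0 with hx | hx
  · rw [tiltKernel_of_nonpos hG hx, measure_univ]
  · rw [← lintegral_one, lintegral_tiltKernel hG hx measurable_const]
    simp only [mul_one]
    exact ENNReal.inv_mul_cancel (hpos x hx)
      (ne_top_of_le_ne_top ENNReal.ofReal_ne_top (tiltMass_le x))

/-- The substitution x = e + G y turns the density e^(-e) on e > 0 into e^(-x) e^(G y) on G y < x.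
-/
lemma lintegral_exp_add (hG : Measurable G) (hG0 : ∀ y, 0 ≤ G y) {φ : ℝ → E → ℝ≥0∞}
    (hφ : Measurable (Function.uncurry φ)) :
    ∫⁻ y, ∫⁻ e, φ (e + G y) y ∂expMeasure 1 ∂m =
      ∫⁻ x in Set.Ioi 0, ENNReal.ofReal (Real.exp (-x)) * ∫⁻ y, tiltWeight G x y * φ x y ∂m := by
  have hinner : ∀ y, ∫⁻ e, φ (e + G y) y ∂expMeasure 1 =
      ∫⁻ x in Set.Ioi 0, ENNReal.ofReal (Real.exp (-x)) * (tiltWeight G x y * φ x y) := by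
    intro y
    have hy : Measurable fun e => φ e y := hφ.of_uncurry_right
    rw [lintegral_expMeasure (φ := fun e => φ (e + G y) y)
      (hy.comp (by fun_prop : Measurable fun e => e + G y)),
      ← lintegral_indicator measurableSet_Ioi, ← lintegral_indicator measurableSet_Ioi,
      ← lintegral_sub_right_eq_self _ (G y)]
    refine lintegral_congr fun x => ?_
    simp only [Set.indicator, Set.mem_Ioi, tiltWeight, sub_pos]
    by_cases h : G y < x
    · simp only [h, if_true, (hG0 y).trans_lt h, sub_add_cancel]
      rw [← mul_assoc, ← ENNReal.ofReal_mul (Real.exp_pos _).le, ← Real.exp_add]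
      congr 3
      ring_nf
    · simp [h]
  simp_rw [hinner]
  rw [lintegral_lintegral_swap]
  · refine lintegral_congr fun x => ?_
    rw [lintegral_const_mul]
    exact (measurable_tiltWeight hG).of_uncurry_left.mul hφ.of_uncurry_left
  · have h1 : Measurable fun p : E × ℝ => tiltWeight G p.2 p.1 :=
      (measurable_tiltWeight hG).comp measurable_swap
    have h2 : Measurable fun p : E × ℝ => φ p.2 p.1 := hφ.comp measurable_swap
    exact ((by fun_prop : Measurable fun p : E × ℝ =>
      ENNReal.ofReal (Real.exp (-p.2))).mul (h1.mul h2)).aemeasurable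

lemma lintegral_exp_add_eq_tiltKernel (hG : Measurable G) (hG0 : ∀ y, 0 ≤ G y)
    (hpos : ∀ x, 0 < x → tiltMass m G x ≠ 0) {φ : ℝ → E → ℝ≥0∞}
    (hφ : Measurable (Function.uncurry φ)) :
    ∫⁻ y, ∫⁻ e, φ (e + G y) y ∂expMeasure 1 ∂m =
      ∫⁻ x in Set.Ioi 0, ENNReal.ofReal (tiltDensity m G x) * ∫⁻ y, φ x y ∂tiltKernel m G x := by
  rw [lintegral_exp_add hG hG0 hφ]
  refine setLIntegral_congr_fun measurableSet_Ioi fun x hx => ?_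
  rw [lintegral_tiltKernel hG hx hφ.of_uncurry_left, ofReal_tiltDensity, mul_assoc,
    ← mul_assoc (tiltMass m G x), ENNReal.mul_inv_cancel (hpos x hx)
      (ne_top_of_le_ne_top ENNReal.ofReal_ne_top (tiltMass_le x)), one_mul]

/-- As a function of x the weight jumps only at x = G y, a null event for each fixed x > 0;
dominated convergence applies. -/
lemma continuousOn_tiltDensity (hG : Measurable G) (hatom : ∀ x, 0 < x → m {y | G y = x} = 0) :
    ContinuousOn (tiltDensity m G) (Set.Ioi 0) := by
  intro x hx
  refine ContinuousAt.continuousWithinAt (ContinuousAt.mul (by fun_prop) ?_)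
  have hlt : ∀ x, tiltMass m G x ≠ ∞ := fun x =>
    ne_top_of_le_ne_top ENNReal.ofReal_ne_top (tiltMass_le x)
  refine (ENNReal.tendsto_toReal (hlt x)).comp ?_
  refine tendsto_lintegral_filter_of_dominated_convergence
    (fun _ => ENNReal.ofReal (Real.exp (x + 1))) ?_ ?_ (by simp) ?_
  · exact Filter.Eventually.of_forall fun x => (measurable_tiltWeight hG).of_uncurry_left
  · filter_upwards [gt_mem_nhds (lt_add_one x)] with z hz
    refine Filter.Eventually.of_forall fun y => ?_
    unfold tiltWeight
    split_ifs with h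
    · exact ENNReal.ofReal_le_ofReal (Real.exp_le_exp.2 (h.trans hz).le)
    · exact zero_le
  · have : ∀ᵐ y ∂m, G y ≠ x := by rw [ae_iff]; simpa using hatom x hx
    filter_upwards [this] with y hy
    refine tendsto_const_nhds.congr' ?_
    rcases lt_or_gt_of_ne hy with h | h
    · filter_upwards [lt_mem_nhds h] with z hz
      simp [tiltWeight, h, hz]
    · filter_upwards [gt_mem_nhds h] with z hz
      simp [tiltWeight, h.not_gt, hz.not_gt]

end Tilt

end

/-! ### The density of the extinction time and the absence of ties. -/

section

lemma part_setClock (e : ℝ) (ξ : Marks) (i : ℕ) : part (setClock e ξ) i = part ξ i := by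
  simp [part]

lemma residualLifetime_setClock (α e : ℝ) (ξ : Marks) :
    residualLifetime α (setClock e ξ) = residualLifetime α ξ := by
  simp [residualLifetime, part_setClock]

variable (α : ℝ)

/-- The time until extinction, as a real number. -/
def lifetimeReal (ξ : Marks) : ℝ := (lifetime α ξ).toReal

/-- The time between the split of the initial block and extinction, as a real number. -/
def residualReal (ξ : Marks) : ℝ := (residualLifetime α ξ).toReal

/-- The time between the split of the initial block and the extinction of the descendants of its
`i`-th sub-block. -/
def branch (ξ : Marks) (i : ℕ) : ℝ := part ξ i ^ (-α) * lifetimeReal α (subtree [i] ξ)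

@[fun_prop]
lemma measurable_lifetimeReal : Measurable (lifetimeReal α) :=
  (measurable_lifetime α).ennreal_toReal

@[fun_prop]
lemma measurable_residualReal : Measurable (residualReal α) :=
  (measurable_residualLifetime α).ennreal_toReal

@[fun_prop]
lemma measurable_branch (i : ℕ) : Measurable fun ξ => branch α ξ i := by
  unfold branch; fun_prop

lemma lifetimeReal_nonneg (ξ : Marks) : 0 ≤ lifetimeReal α ξ := ENNReal.toReal_nonneg

lemma residualReal_nonneg (ξ : Marks) : 0 ≤ residualReal α ξ := ENNReal.toReal_nonneg

lemma residualReal_setClock (e : ℝ) (ξ : Marks) :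
    residualReal α (setClock e ξ) = residualReal α ξ := by
  simp [residualReal, residualLifetime_setClock]

lemma branch_eq_toReal (ξ : Marks) (i : ℕ) : branch α ξ i =
    (ENNReal.ofReal (part ξ i ^ (-α)) * lifetime α (subtree [i] ξ)).toReal := by
  rw [ENNReal.toReal_mul, ENNReal.toReal_ofReal (Real.rpow_nonneg (part_nonneg ξ i) _)]
  rfl

variable (ν : Measure massPartitions) [IsProbabilityMeasure ν]

lemma ae_root_clock_pos : ∀ᵐ ξ ∂marksLaw ν, 0 < (ξ []).1 := by
  have : ∀ᵐ a ∂(expMeasure 1).prod ν, 0 < a.1 :=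
    Measure.quasiMeasurePreserving_fst.ae ae_pos_expMeasure
  exact (measurePreserving_root ν).quasiMeasurePreserving.ae this

variable {ν} in
lemma ae_part_zero_lt_one (hν : ν {s | (s : ℕ → ℝ) = Pi.single 0 1} = 0) :
    ∀ᵐ ξ ∂marksLaw ν, part ξ 0 < 1 := by
  have : ∀ᵐ a ∂(expMeasure 1).prod ν, (a.2 : ℕ → ℝ) 0 < 1 :=
    Measure.quasiMeasurePreserving_snd.ae (ae_lt_one hν)
  exact (measurePreserving_root ν).quasiMeasurePreserving.ae this

variable {α} {ν}

lemma residualLifetime_lt_top {ξ : Marks} (h : lifetime α ξ < ∞) : residualLifetime α ξ < ∞ :=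
  lt_of_le_of_lt (by rw [lifetime_eq]; exact le_add_self) h

lemma lifetimeReal_eq {ξ : Marks} (h0 : 0 < (ξ []).1) (h : lifetime α ξ < ∞) :
    lifetimeReal α ξ = (ξ []).1 + residualReal α ξ := by
  rw [lifetimeReal, lifetime_eq, ENNReal.toReal_add ENNReal.ofReal_ne_top
    (residualLifetime_lt_top h).ne, ENNReal.toReal_ofReal h0.le, residualReal]

/-- The condition `hφ0` says that φ does not see the clock of the initial block, which can therefore
be integrated out independently of the rest. -/
lemma lintegral_lifetimeReal_joint (hα : α < 0) (hν : ν {s | (s : ℕ → ℝ) = Pi.single 0 1} = 0)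
    {φ : ℝ → Marks → ℝ≥0∞} (hφ : Measurable (Function.uncurry φ))
    (hφ0 : ∀ x ξ, φ x (setClock 0 ξ) = φ x ξ) :
    ∫⁻ ξ, φ (lifetimeReal α ξ) ξ ∂marksLaw ν =
      ∫⁻ ξ, ∫⁻ e, φ (e + residualReal α ξ) ξ ∂expMeasure 1 ∂marksLaw ν := by
  have h := lintegral_resample_clock ν (φ := fun e ξ => φ (e + residualReal α ξ) ξ)
    (hφ.comp (by fun_prop : Measurable fun p : ℝ × Marks => (p.1 + residualReal α p.2, p.2)))
  simp only [residualReal_setClock, hφ0] at h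
  rw [← h]
  refine lintegral_congr_ae ?_
  filter_upwards [ae_root_clock_pos ν, ae_lifetime_lt_top hα hν] with ξ h0 h1
  rw [lifetimeReal_eq h0 h1]

variable (α ν) in
/-- The density of the extinction time. -/
def extinctionDensity : ℝ → ℝ := tiltDensity (marksLaw ν) (residualReal α)

lemma lintegral_lifetimeReal (hα : α < 0) (hν : ν {s | (s : ℕ → ℝ) = Pi.single 0 1} = 0)
    {φ : ℝ → ℝ≥0∞} (hφ : Measurable φ) :
    ∫⁻ ξ, φ (lifetimeReal α ξ) ∂marksLaw ν =
      ∫⁻ x in Set.Ioi 0, ENNReal.ofReal (extinctionDensity α ν x) * φ x := by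
  rw [lintegral_lifetimeReal_joint hα hν (φ := fun x _ => φ x) (hφ.comp measurable_fst)
    (fun _ _ => rfl), lintegral_exp_add (measurable_residualReal α) (residualReal_nonneg α)
    (φ := fun x _ => φ x) (hφ.comp measurable_fst)]
  refine lintegral_congr fun x => ?_
  rw [lintegral_mul_const _ (measurable_tiltWeight (measurable_residualReal α)).of_uncurry_left,
    extinctionDensity, ofReal_tiltDensity, tiltMass, mul_assoc]

lemma measurable_extinctionDensity : Measurable (extinctionDensity α ν) :=
  (by fun_prop : Measurable fun x : ℝ => Real.exp (-x)).mul
    (measurable_tiltMass (measurable_residualReal α)).ennreal_toReal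

lemma map_lifetimeReal (hα : α < 0) (hν : ν {s | (s : ℕ → ℝ) = Pi.single 0 1} = 0) :
    (marksLaw ν).map (lifetimeReal α) = (volume.restrict (Set.Ioi 0)).withDensity
      fun x => ENNReal.ofReal (extinctionDensity α ν x) := by
  refine Measure.ext_of_lintegral _ fun φ hφ => ?_
  rw [lintegral_map hφ (measurable_lifetimeReal α), lintegral_lifetimeReal hα hν hφ,
    lintegral_withDensity_eq_lintegral_mul _ measurable_extinctionDensity.ennreal_ofReal hφ]
  rfl

lemma measure_lifetimeReal_eq (hα : α < 0) (hν : ν {s | (s : ℕ → ℝ) = Pi.single 0 1} = 0)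
    (c : ℝ) : marksLaw ν {ξ | lifetimeReal α ξ = c} = 0 := by
  change marksLaw ν (lifetimeReal α ⁻¹' {c}) = 0
  rw [← Measure.map_apply (measurable_lifetimeReal α) (measurableSet_singleton c),
    map_lifetimeReal hα hν]
  exact ((withDensity_absolutelyContinuous _ _).trans Measure.restrict_le_self.absolutelyContinuous)
    (measure_singleton c)

lemma part_congr {i : ℕ} {ξ ξ' : Marks} (h : ∀ v, ¬ [i] <:+ v → ξ v = ξ' v) :
    part ξ = part ξ' := by
  ext j; rw [part, part, h [] (by simp)]

lemma subtree_congr {i j : ℕ} (hij : j ≠ i) {ξ ξ' : Marks}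
    (h : ∀ v, ¬ [i] <:+ v → ξ v = ξ' v) : subtree [j] ξ = subtree [j] ξ' := by
  ext1 v
  refine h _ fun hs => hij ?_
  obtain ⟨w, hw⟩ := hs
  have := List.append_inj_right' hw rfl
  simp only [List.cons.injEq, and_true] at this
  exact this.symm

/-- Resample the `i`-th subtree: `c` and the factor of the branch stay fixed while the lifetime is
diffuse. Equality has positive conditional probability only if that factor is 0, and then `c` is 0.
-/
lemma ae_branch_eq_imp (hα : α < 0) (hν : ν {s | (s : ℕ → ℝ) = Pi.single 0 1} = 0)
    (i : ℕ) {c : Marks → ℝ} (hc : Measurable c)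
    (hdep : ∀ ξ ξ', (∀ v, ¬ [i] <:+ v → ξ v = ξ' v) → c ξ = c ξ') :
    ∀ᵐ ξ ∂marksLaw ν, branch α ξ i = c ξ → c ξ = 0 := by
  have hm : MeasurableSet {p : Marks × Marks |
      part p.1 i ^ (-α) * lifetimeReal α p.2 = c p.1 ∧ c p.1 ≠ 0} :=
    (measurableSet_eq_fun (by fun_prop) (by fun_prop)).inter
      (measurableSet_eq_fun (by fun_prop) measurable_const).compl
  have := lintegral_resample_subtree ν i
    (φ := fun ξ η => {p : Marks × Marks |
      part p.1 i ^ (-α) * lifetimeReal α p.2 = c p.1 ∧ c p.1 ≠ 0}.indicator 1 (ξ, η))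
    (measurable_one.indicator hm) (fun ξ ξ' η h => by
      simp [Set.indicator, part_congr h, hdep ξ ξ' h])
  have hz : ∀ ξ, ∫⁻ η, {p : Marks × Marks |
      part p.1 i ^ (-α) * lifetimeReal α p.2 = c p.1 ∧ c p.1 ≠ 0}.indicator 1 (ξ, η)
        ∂marksLaw ν = (0 : ℝ≥0∞) := by
    intro ξ
    have : (fun η => {p : Marks × Marks |
      part p.1 i ^ (-α) * lifetimeReal α p.2 = c p.1 ∧ c p.1 ≠ 0}.indicator
        (1 : Marks × Marks → ℝ≥0∞) (ξ, η))
        = {η | part ξ i ^ (-α) * lifetimeReal α η = c ξ ∧ c ξ ≠ 0}.indicator 1 := rfl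
    have hmξ : MeasurableSet {η | part ξ i ^ (-α) * lifetimeReal α η = c ξ ∧ c ξ ≠ 0} :=
      hm.preimage (by fun_prop : Measurable fun η : Marks => (ξ, η))
    rw [this, lintegral_indicator_one hmξ]
    refine measure_mono_null ?_ (measure_lifetimeReal_eq hα hν (c ξ / part ξ i ^ (-α)))
    rintro η ⟨h1, h2⟩
    have h3 : part ξ i ^ (-α) ≠ 0 := by
      rintro h0; rw [h0, zero_mul] at h1; exact h2 h1.symm
    rw [Set.mem_ofPred_eq, ← h1]
    field_simp
  rw [lintegral_congr hz, lintegral_zero] at this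
  have hm' : MeasurableSet {ξ : Marks | branch α ξ i = c ξ ∧ c ξ ≠ 0} :=
    hm.preimage (by fun_prop : Measurable fun ξ : Marks => (ξ, subtree [i] ξ))
  rw [ae_iff, ← this, ← lintegral_indicator_one]
  · refine lintegral_congr fun ξ => ?_
    simp [Set.indicator, branch]
  · simpa using hm'

lemma ae_branch_eq_const_imp (hα : α < 0) (hν : ν {s | (s : ℕ → ℝ) = Pi.single 0 1} = 0) (x : ℝ) :
    ∀ᵐ ξ ∂marksLaw ν, ∀ i, branch α ξ i = x → x = 0 :=
  ae_all_iff.2 fun i => ae_branch_eq_imp hα hν i measurable_const fun _ _ _ => rfl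

lemma ae_branch_eq_branch_imp (hα : α < 0) (hν : ν {s | (s : ℕ → ℝ) = Pi.single 0 1} = 0) :
    ∀ᵐ ξ ∂marksLaw ν, ∀ i j, i ≠ j → branch α ξ i = branch α ξ j → branch α ξ j = 0 := by
  refine ae_all_iff.2 fun i => ae_all_iff.2 fun j => ?_
  by_cases hij : i = j
  · exact Filter.Eventually.of_forall fun _ h => absurd hij h
  · filter_upwards [ae_branch_eq_imp hα hν i (c := fun ξ => branch α ξ j) (by fun_prop)
      fun ξ ξ' h => by simp [branch, part_congr h, subtree_congr (Ne.symm hij) h]] with ξ h _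
    exact h

/-- Summable p-th powers tend to 0, so beyond some rank all terms stay below a level under the
supremum, and the supremum is a maximum over finitely many terms. -/
lemma exists_eq_iSup_of_tsum_rpow_lt_top {f : ℕ → ℝ≥0∞} {p : ℝ} (hp : 0 < p)
    (h : ∑' i, f i ^ p < ∞) : ∃ i, f i = ⨆ i, f i := by
  rcases eq_or_ne (⨆ i, f i) 0 with h0 | h0
  · exact ⟨0, by rw [h0]; exact le_zero_iff.1 (h0 ▸ le_iSup f 0)⟩
  have ht : Filter.Tendsto (fun i => f i ^ p) Filter.atTop (nhds 0) :=
    ENNReal.tendsto_atTop_zero_of_tsum_ne_top h.ne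
  have hpos : 0 < (⨆ i, f i) ^ p := ENNReal.rpow_pos_of_nonneg (pos_iff_ne_zero.2 h0) hp.le
  by_contra! hne
  obtain ⟨c, hc0, hc⟩ := exists_between hpos
  obtain ⟨N, hN⟩ := Filter.eventually_atTop.1 (ht.eventually (gt_mem_nhds hc0))
  have hlt : ∀ i, f i < ⨆ i, f i := fun i => lt_of_le_of_ne (le_iSup f i) (hne i)
  have hc' : c ^ p⁻¹ < ⨆ i, f i := by
    rwa [ENNReal.rpow_inv_lt_iff hp]
  -- The range is `N + 1` only to make the finite maximum run over a nonempty set.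
  have hle : ∀ i, f i ≤ max (c ^ p⁻¹) ((Finset.range (N + 1)).sup' (by simp) f) := by
    intro i
    rcases lt_or_ge i N with hi | hi
    · exact le_max_of_le_right (Finset.le_sup' f (by simp; omega))
    · exact le_max_of_le_left ((ENNReal.le_rpow_inv_iff hp).2 (hN i hi).le)
  have := iSup_le hle
  refine absurd this (not_le.2 (max_lt hc' ?_))
  obtain ⟨i, -, hi⟩ := Finset.exists_mem_eq_sup' (s := Finset.range (N + 1)) (by simp) f
  exact hi ▸ hlt i

lemma exists_branch_eq (hα : α < 0) {ξ : Marks} (h : generationSum α 1 ξ < ∞) :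
    ∃ i, ENNReal.ofReal (part ξ i ^ (-α)) * lifetime α (subtree [i] ξ) = residualLifetime α ξ := by
  have hp : 0 < 1 - α⁻¹ := by have := inv_lt_zero.2 hα; linarith
  refine exists_eq_iSup_of_tsum_rpow_lt_top hp (lt_of_eq_of_lt (tsum_congr fun i => ?_) h)
  rw [ENNReal.mul_rpow_of_nonneg _ _ hp.le, ofReal_rpow_neg_rpow hα (part_nonneg ξ i)]
  rfl

lemma ae_generationSum_one_lt_top (hα : α < 0) (hν : ν {s | (s : ℕ → ℝ) = Pi.single 0 1} = 0) :
    ∀ᵐ ξ ∂marksLaw ν, generationSum α 1 ξ < ∞ := by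
  filter_upwards [ae_tsum_generationSum_lt_top hα hν] with ξ h
  exact (ENNReal.le_tsum 1).trans_lt h

/-- The residual time equals one of the countably many branches, and none of these has an atom in
(0, ∞). -/
lemma measure_residualReal_eq (hα : α < 0) (hν : ν {s | (s : ℕ → ℝ) = Pi.single 0 1} = 0)
    {x : ℝ} (hx : 0 < x) : marksLaw ν {ξ | residualReal α ξ = x} = 0 := by
  have : ∀ᵐ ξ ∂marksLaw ν, residualReal α ξ ≠ x := by
    filter_upwards [ae_branch_eq_const_imp hα hν x, ae_generationSum_one_lt_top hα hν]
      with ξ h1 h2 h3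
    obtain ⟨i, hi⟩ := exists_branch_eq hα h2
    refine hx.ne' (h1 i ?_)
    rw [← h3, residualReal, ← hi, branch_eq_toReal]
  rw [ae_iff] at this
  simpa using this

end

/-! ### Independence of infinitely many subtrees, and positivity of the density. -/

section

variable {ν : Measure massPartitions} [IsProbabilityMeasure ν] {α : ℝ}

lemma measure_finset_subtree (J : Finset ℕ) {C : ℕ → Set Marks} (hC : ∀ j, MeasurableSet (C j)) :
    marksLaw ν {ξ | ∀ j ∈ J, subtree [j] ξ ∈ C j} = ∏ j ∈ J, marksLaw ν (C j) := by
  have h := lintegral_prod_subtree ν J (h := fun _ => 1) measurable_const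
    (g := fun j _ η => (C j).indicator 1 η)
    (fun j => (measurable_one.indicator (hC j)).comp measurable_snd)
  simp only [one_mul, lintegral_indicator_one (hC _), lintegral_const, measure_univ, mul_one] at h
  rw [← h, ← lintegral_indicator_one]
  · refine lintegral_congr fun ξ => ?_
    classical
    by_cases hξ : ∀ j ∈ J, subtree [j] ξ ∈ C j
    · rw [Set.indicator_of_mem (show ξ ∈ {ξ | ∀ j ∈ J, subtree [j] ξ ∈ C j} from hξ),
        Finset.prod_eq_one fun j hj => Set.indicator_of_mem (hξ j hj) _]
      rfl
    · rw [Set.indicator_of_notMem (show ξ ∉ {ξ | ∀ j ∈ J, subtree [j] ξ ∈ C j} from hξ)]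
      push Not at hξ
      obtain ⟨j, hj, hjC⟩ := hξ
      rw [Finset.prod_eq_zero hj (Set.indicator_of_notMem hjC _)]
  · simp only [Set.ofPred_forall]
    exact Finset.measurableSet_biInter _ fun j _ => measurable_subtree [j] (hC j)

lemma measure_forall_subtree {C : ℕ → Set Marks} (hC : ∀ j, MeasurableSet (C j)) :
    marksLaw ν {ξ | ∀ j, subtree [j] ξ ∈ C j} = ⨅ J : Finset ℕ, ∏ j ∈ J, marksLaw ν (C j) := by
  have hset : {ξ | ∀ j, subtree [j] ξ ∈ C j} =
      ⋂ J : Finset ℕ, {ξ | ∀ j ∈ J, subtree [j] ξ ∈ C j} := by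
    ext ξ
    simp only [Set.mem_ofPred_eq, Set.mem_iInter]
    exact ⟨fun h J j _ => h j, fun h j => h {j} j (by simp)⟩
  rw [hset, Directed.measure_iInter]
  · exact iInf_congr fun J => measure_finset_subtree J hC
  · intro J
    refine MeasurableSet.nullMeasurableSet ?_
    simp only [Set.ofPred_forall]
    exact Finset.measurableSet_biInter _ fun j _ => measurable_subtree [j] (hC j)
  · classical
    intro J K
    exact ⟨J ∪ K, fun ξ h j hj => h j (Finset.mem_union_left _ hj),
      fun ξ h j hj => h j (Finset.mem_union_right _ hj)⟩
  · exact ⟨∅, measure_ne_top _ _⟩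

/-- The finite products decrease, so the net over finite sets converges to its infimum, which is the
probability of the full intersection. -/
lemma measureReal_forall_subtree {C : ℕ → Set Marks} (hC : ∀ j, MeasurableSet (C j)) :
    (marksLaw ν).real {ξ | ∀ j, subtree [j] ξ ∈ C j} = ∏' j, (marksLaw ν).real (C j) := by
  symm
  refine HasProd.tprod_eq ?_
  have hanti : Antitone fun J : Finset ℕ => ∏ j ∈ J, (marksLaw ν).real (C j) := fun J K h =>
    Finset.prod_le_prod_of_subset_of_le_one h (fun _ _ => measureReal_nonneg)
      (fun _ _ _ => measureReal_le_one)
  have hbdd : BddBelow (Set.range fun J : Finset ℕ => ∏ j ∈ J, (marksLaw ν).real (C j)) :=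
    ⟨0, by rintro _ ⟨J, rfl⟩; exact Finset.prod_nonneg fun _ _ => measureReal_nonneg⟩
  have ht := tendsto_atTop_ciInf hanti hbdd
  have : (marksLaw ν).real {ξ | ∀ j, subtree [j] ξ ∈ C j} =
      ⨅ J : Finset ℕ, ∏ j ∈ J, (marksLaw ν).real (C j) := by
    rw [measureReal_def, measure_forall_subtree hC, ENNReal.toReal_iInf]
    · simp [ENNReal.toReal_prod, measureReal_def]
    · exact fun J => ENNReal.prod_ne_top fun _ _ => measure_ne_top _ _
  rw [this]
  simpa [HasProd] using ht

/-- A union bound makes the constraints beyond some `N` jointly possible; the first `N` only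
contribute a positive finite product, by independence. -/
lemma measure_forall_subtree_pos {C : ℕ → Set Marks} (hC : ∀ j, MeasurableSet (C j))
    (hpos : ∀ j, marksLaw ν (C j) ≠ 0) (hsum : ∑' j, marksLaw ν (C j)ᶜ ≠ ∞) :
    marksLaw ν {ξ | ∀ j, subtree [j] ξ ∈ C j} ≠ 0 := by
  classical
  obtain ⟨N, hN⟩ : ∃ N : ℕ, ∑' j, marksLaw ν (C (j + N))ᶜ < 1 :=
    ((ENNReal.tendsto_sum_nat_add _ hsum).eventually (gt_mem_nhds one_pos)).exists
  set D : ℕ → Set Marks := fun j => if j < N then Set.univ else C j with hD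
  have hDm : ∀ j, MeasurableSet (D j) := fun j => by
    by_cases h : j < N <;> simp [hD, h, hC j]
  have hDpos : 0 < marksLaw ν {ξ | ∀ j, subtree [j] ξ ∈ D j} := by
    have hc : marksLaw ν {ξ | ∀ j, subtree [j] ξ ∈ D j}ᶜ < 1 := by
      refine lt_of_le_of_lt (le_trans (measure_mono (t := ⋃ j, subtree [j + N] ⁻¹' (C (j + N))ᶜ)
        fun ξ hξ => ?_) (measure_iUnion_le _)) (lt_of_eq_of_lt (tsum_congr fun j => ?_) hN)
      · simp only [Set.mem_compl_iff, Set.mem_ofPred_eq, not_forall] at hξ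
        obtain ⟨j, hj⟩ := hξ
        have hjN : N ≤ j := by
          by_contra h
          exact hj (by simp [hD, not_le.1 h])
        refine Set.mem_iUnion.2 ⟨j - N, ?_⟩
        rw [Nat.sub_add_cancel hjN]
        simpa [hD, hjN.not_gt] using hj
      · exact (measurePreserving_subtree ν [j + N]).measure_preimage
          (hC _).compl.nullMeasurableSet
    by_contra h
    rw [not_lt, le_zero_iff] at h
    have h1 := measure_union_le (μ := marksLaw ν) {ξ | ∀ j, subtree [j] ξ ∈ D j}
      {ξ | ∀ j, subtree [j] ξ ∈ D j}ᶜ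
    rw [Set.union_compl_self, measure_univ, h, zero_add] at h1
    exact absurd hc h1.not_gt
  have hprod : 0 < ∏ j ∈ Finset.range N, marksLaw ν (C j) :=
    pos_iff_ne_zero.2 (Finset.prod_ne_zero_iff.2 fun j _ => hpos j)
  refine (lt_of_lt_of_le (ENNReal.mul_pos hprod.ne' hDpos.ne') ?_).ne'
  rw [measure_forall_subtree hC]
  refine le_iInf fun J => ?_
  have h1 : marksLaw ν {ξ | ∀ j, subtree [j] ξ ∈ D j} ≤
      ∏ j ∈ J \ Finset.range N, marksLaw ν (C j) := by
    rw [measure_forall_subtree hDm]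
    refine (iInf_le _ (J \ Finset.range N)).trans (le_of_eq (Finset.prod_congr rfl fun j hj => ?_))
    have : ¬ j < N := by simpa using (Finset.mem_sdiff.1 hj).2
    simp [hD, this]
  calc _ ≤ (∏ j ∈ J ∩ Finset.range N, marksLaw ν (C j)) *
        ∏ j ∈ J \ Finset.range N, marksLaw ν (C j) := by
        refine mul_le_mul' ?_ h1
        exact Finset.prod_le_prod_of_subset_of_le_one' Finset.inter_subset_right
          fun _ _ _ => prob_le_one
    _ = _ := Finset.prod_inter_mul_prod_sdiff _ _ _

lemma lintegral_part_eq {φ : Marks → ℝ≥0∞} (hφ : Measurable φ) :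
    ∫⁻ ξ, φ ξ ∂marksLaw ν =
      ∫⁻ s, ∫⁻ ξ, ∫⁻ e, φ (Function.update ξ [] (e, s)) ∂expMeasure 1 ∂marksLaw ν ∂ν := by
  rw [lintegral_resample_root ν hφ]
  have hu : Measurable fun p : Marks × (ℝ × massPartitions) => Function.update p.1 [] p.2 := by
    refine measurable_pi_iff.2 fun v => ?_
    by_cases hv : v = []
    · subst hv; simp only [Function.update_self]; fun_prop
    · simp only [Function.update_of_ne hv]; fun_prop
  have h1 : ∀ ξ, ∫⁻ a, φ (Function.update ξ [] a) ∂(expMeasure 1).prod ν =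
      ∫⁻ s, ∫⁻ e, φ (Function.update ξ [] (e, s)) ∂expMeasure 1 ∂ν := fun ξ =>
    lintegral_prod_symm _ (hφ.comp (measurable_update ξ)).aemeasurable
  simp_rw [h1]
  rw [lintegral_lintegral_swap]
  have : Measurable fun p : (Marks × massPartitions) × ℝ =>
      φ (Function.update p.1.1 [] (p.2, p.1.2)) :=
    (hφ.comp hu).comp (by fun_prop : Measurable fun p : (Marks × massPartitions) × ℝ =>
      (p.1.1, (p.2, p.1.2)))
  exact this.lintegral_prod_right'.aemeasurable

/-- Given the relative masses of the sub-blocks of the initial block, the descendants of these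
sub-blocks have law `marksLaw ν` and are independent. -/
lemma lintegral_part_subtree {φ : massPartitions → Marks → ℝ≥0∞}
    (hφ : Measurable (Function.uncurry φ))
    (hdep : ∀ s ξ a, φ s (Function.update ξ [] a) = φ s ξ) :
    ∫⁻ ξ, φ (ξ []).2 ξ ∂marksLaw ν = ∫⁻ s, ∫⁻ ξ, φ s ξ ∂marksLaw ν ∂ν := by
  rw [lintegral_part_eq (φ := fun ξ => φ (ξ []).2 ξ)
    (hφ.comp (by fun_prop : Measurable fun ξ : Marks => ((ξ []).2, ξ)))]
  simp [hdep]

lemma measure_part_subtree {A : Set (massPartitions × Marks)} (hA : MeasurableSet A)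
    (hdep : ∀ s ξ a, (s, Function.update ξ [] a) ∈ A ↔ (s, ξ) ∈ A) :
    marksLaw ν {ξ | ((ξ []).2, ξ) ∈ A} = ∫⁻ s, marksLaw ν {ξ | (s, ξ) ∈ A} ∂ν := by
  have h := lintegral_part_subtree (ν := ν) (φ := fun s ξ => A.indicator 1 (s, ξ))
    (measurable_one.indicator hA) fun s ξ a => Set.indicator_eq_indicator (hdep s ξ a) rfl
  have h1 : ∫⁻ ξ, A.indicator 1 ((ξ []).2, ξ) ∂marksLaw ν = marksLaw ν {ξ | ((ξ []).2, ξ) ∈ A} :=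
    lintegral_indicator_one (hA.preimage (by fun_prop : Measurable fun ξ : Marks => ((ξ []).2, ξ)))
  rw [← h1, h]
  exact lintegral_congr fun s => lintegral_indicator_one
    (hA.preimage (by fun_prop : Measurable fun ξ : Marks => (s, ξ)))

lemma subtree_update_root (i : ℕ) (ξ : Marks) (a : ℝ × massPartitions) :
    subtree [i] (Function.update ξ [] a) = subtree [i] ξ := by
  ext1 v; simp [subtree]

lemma tiltMass_ne_zero {E : Type*} [MeasurableSpace E] {m : Measure E} {G : E → ℝ}
    (hG : Measurable G) {x : ℝ} (h : m {y | G y < x} ≠ 0) : tiltMass m G x ≠ 0 := by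
  rw [tiltMass, ← pos_iff_ne_zero, lintegral_pos_iff_support
    (measurable_tiltWeight hG).of_uncurry_left]
  refine pos_iff_ne_zero.2 fun h0 => h (measure_mono_null (fun y hy => ?_) h0)
  have hy' : G y < x := hy
  simp [tiltWeight, hy', Real.exp_pos]

lemma tsum_part_le_one (hα : α < 0) (s : massPartitions) :
    ∑' i, ENNReal.ofReal ((s : ℕ → ℝ) i ^ (1 - α)) ≤ 1 := by
  calc _ ≤ ∑' i, ENNReal.ofReal ((s : ℕ → ℝ) i) := by
        refine ENNReal.tsum_le_tsum fun i => ENNReal.ofReal_le_ofReal ?_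
        exact (Real.rpow_le_rpow_of_exponent_ge' (s.2.2.1 i)
          (le_hasSum s.2.2.2 i fun j _ => s.2.2.1 j) zero_le_one (by linarith)).trans_eq
            (Real.rpow_one _)
    _ = 1 := by
        rw [← ENNReal.ofReal_tsum_of_nonneg s.2.2.1 s.2.2.2.summable, s.2.2.2.tsum_eq,
          ENNReal.ofReal_one]

/-- If s_0^(-α) < c, every sub-block with lifetime below `y` contributes at most `c * y`. Each such
event has positive probability, and the small sub-blocks violate the bound with summable
probabilities, so all bounds can hold together. -/
lemma measure_residualReal_lt_ne_zero_of_ratio (hα : α < 0)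
    (hν : ν {s | (s : ℕ → ℝ) = Pi.single 0 1} = 0) {c y x : ℝ} (hc : 0 < c) (hy : 0 < y)
    (hratio : ν {s : massPartitions | (s : ℕ → ℝ) 0 ^ (-α) < c} ≠ 0)
    (hp : marksLaw ν {ξ | lifetime α ξ < ENNReal.ofReal y} ≠ 0) (hx : c * y < x) :
    marksLaw ν {ξ | residualReal α ξ < x} ≠ 0 := by
  have hp0 : 0 < 1 - α⁻¹ := by have := inv_lt_zero.2 hα; linarith
  have hcy : 0 < c * y := mul_pos hc hy
  set C : massPartitions → ℕ → Set Marks := fun s j =>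
    {η | ENNReal.ofReal ((s : ℕ → ℝ) j ^ (-α)) * lifetime α η ≤ ENNReal.ofReal (c * y)} with hCdef
  have hCm : ∀ s j, MeasurableSet (C s j) := fun s j =>
    measurableSet_le (by fun_prop) measurable_const
  have hpos : ∀ s : massPartitions, (s : ℕ → ℝ) 0 ^ (-α) < c →
      marksLaw ν {ξ | ∀ j, subtree [j] ξ ∈ C s j} ≠ 0 := by
    intro s hs
    refine measure_forall_subtree_pos (hCm s) (fun j h0 => hp (measure_mono_null ?_ h0)) ?_
    · intro η hη
      rw [hCdef]
      simp only [Set.mem_ofPred_eq]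
      rw [ENNReal.ofReal_mul hc.le]
      refine mul_le_mul' (ENNReal.ofReal_le_ofReal (le_trans ?_ hs.le)) (le_of_lt hη)
      exact Real.rpow_le_rpow (s.2.2.1 j) (s.2.1 (Nat.zero_le j)) (by linarith)
    · set M := ∫⁻ ξ, lifetime α ξ ^ (1 - α⁻¹) ∂marksLaw ν with hM
      have hMtop := lintegral_lifetime_rpow_lt_top (ν := ν) hα hν
      set K := ENNReal.ofReal (c * y) ^ (1 - α⁻¹) with hK
      have hK0 : K ≠ 0 := (ENNReal.rpow_pos (ENNReal.ofReal_pos.2 hcy) ENNReal.ofReal_ne_top).ne'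
      have hKtop : K ≠ ∞ := (ENNReal.rpow_lt_top_of_nonneg hp0.le ENNReal.ofReal_ne_top).ne
      -- Markov's inequality for the p-th power, whose weight s_j^(1-α) is summable in j.
      have hle : ∀ j, marksLaw ν (C s j)ᶜ ≤ ENNReal.ofReal ((s : ℕ → ℝ) j ^ (1 - α)) * (M / K) := by
        intro j
        have h1 := meas_ge_le_lintegral_div (μ := marksLaw ν)
          (f := fun η => ENNReal.ofReal ((s : ℕ → ℝ) j ^ (1 - α)) * lifetime α η ^ (1 - α⁻¹))
          (by fun_prop) hK0 hKtop
        rw [lintegral_const_mul _ (by fun_prop), mul_div_assoc] at h1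
        refine le_trans (measure_mono fun η hη => ?_) h1
        simp only [hCdef, Set.mem_compl_iff, Set.mem_ofPred_eq, not_le] at hη ⊢
        rw [← ofReal_rpow_neg_rpow hα (s.2.2.1 j), ← ENNReal.mul_rpow_of_nonneg _ _ hp0.le]
        exact ENNReal.rpow_le_rpow hη.le hp0.le
      refine ne_top_of_le_ne_top ?_ (ENNReal.tsum_le_tsum hle)
      rw [ENNReal.tsum_mul_right]
      exact ENNReal.mul_ne_top (ne_top_of_le_ne_top ENNReal.one_ne_top (tsum_part_le_one hα s))
        (ENNReal.div_ne_top hMtop.ne hK0)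
  intro h0
  have h1 : marksLaw ν {ξ | ∀ j, subtree [j] ξ ∈ C (ξ []).2 j} = 0 := by
    refine measure_mono_null (fun ξ hξ => ?_) h0
    have : residualLifetime α ξ ≤ ENNReal.ofReal (c * y) := iSup_le hξ
    exact lt_of_le_of_lt (ENNReal.toReal_le_of_le_ofReal hcy.le this) hx
  have hmS : MeasurableSet {p : massPartitions × Marks | ∀ j, subtree [j] p.2 ∈ C p.1 j} := by
    simp only [Set.ofPred_forall, hCdef, Set.mem_ofPred_eq]
    refine MeasurableSet.iInter fun j => measurableSet_le (Measurable.mul ?_ (by fun_prop))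
      measurable_const
    exact (measurable_ofReal_apply_rpow j _).comp measurable_fst
  have h2 := measure_part_subtree (ν := ν) hmS fun s ξ a => by
    have h (j : ℕ) : subtree [j] (Function.update ξ [] a) = subtree [j] ξ :=
      subtree_update_root j ξ a
    simp only [Set.mem_ofPred_eq, h]
  simp only [Set.mem_ofPred_eq] at h2
  rw [h1] at h2
  have h5 : Measurable fun s => marksLaw ν {ξ | ∀ j, subtree [j] ξ ∈ C s j} :=
    measurable_measure_prodMk_left hmS
  rw [eq_comm, lintegral_eq_zero_iff h5] at h2
  refine hratio (measure_mono_null (fun s hs => ?_) (ae_iff.1 h2))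
  exact hpos s hs

lemma exists_ratio (hα : α < 0) (hν : ν {s | (s : ℕ → ℝ) = Pi.single 0 1} = 0) :
    ∃ c : ℝ, 0 < c ∧ c < 1 ∧ ν {s : massPartitions | (s : ℕ → ℝ) 0 ^ (-α) < c} ≠ 0 := by
  by_contra! h
  have h1 : ∀ n : ℕ, ∀ᵐ s : massPartitions ∂ν, ¬ (s : ℕ → ℝ) 0 ^ (-α) < 1 - 1 / ((n : ℝ) + 2) := by
    intro n
    rw [ae_iff]
    have hn : (0 : ℝ) ≤ n := Nat.cast_nonneg n
    have := h (1 - 1 / ((n : ℝ) + 2)) (by rw [sub_pos, div_lt_one] <;> linarith)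
      (by rw [sub_lt_self_iff]; positivity)
    simp only [not_not]
    exact this
  obtain ⟨s, hs1, hs2⟩ := ((ae_all_iff.2 h1).and (ae_lt_one hν)).exists
  have hlt : (s : ℕ → ℝ) 0 ^ (-α) < 1 := Real.rpow_lt_one (s.2.2.1 0) hs2 (by linarith)
  obtain ⟨n, hn⟩ := exists_nat_one_div_lt (sub_pos.2 hlt)
  refine hs1 n ?_
  have : 1 / ((n : ℝ) + 2) ≤ 1 / ((n : ℝ) + 1) :=
    one_div_le_one_div_of_le (by positivity) (by linarith)
  linarith

/-- If R < x has positive probability, the density of the lifetime is positive beyond `x`, so the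
interval (x, z) is charged. -/
lemma measure_lifetime_lt_ne_zero_of_residual (hα : α < 0)
    (hν : ν {s | (s : ℕ → ℝ) = Pi.single 0 1} = 0) {x z : ℝ} (hx : 0 < x)
    (h : marksLaw ν {ξ | residualReal α ξ < x} ≠ 0) (hz : x < z) :
    marksLaw ν {ξ | lifetime α ξ < ENNReal.ofReal z} ≠ 0 := by
  intro h0
  have h1 : marksLaw ν {ξ | lifetimeReal α ξ < z} = 0 := by
    rw [measure_eq_zero_iff_ae_notMem] at h0 ⊢
    filter_upwards [h0, ae_lifetime_lt_top hα hν] with ξ h1 h2 h3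
    exact h1 ((ENNReal.lt_ofReal_iff_toReal_lt h2.ne).2 h3)
  have h2 := lintegral_lifetimeReal hα hν (φ := (Set.Iio z).indicator 1)
    (measurable_one.indicator measurableSet_Iio)
  have h3 : ∫⁻ ξ, (Set.Iio z).indicator (1 : ℝ → ℝ≥0∞) (lifetimeReal α ξ) ∂marksLaw ν = 0 := by
    rw [← h1, ← lintegral_indicator_one (measurableSet_lt (by fun_prop) measurable_const)]
    rfl
  rw [h3, eq_comm, setLIntegral_eq_zero_iff
    (f := fun x => ENNReal.ofReal (extinctionDensity α ν x) * (Set.Iio z).indicator 1 x)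
    measurableSet_Ioi (measurable_extinctionDensity.ennreal_ofReal.mul
      (measurable_one.indicator measurableSet_Iio))]
    at h2
  have h4 : volume (Set.Ioo x z) ≠ 0 := by simpa using hz
  refine h4 (measure_mono_null (fun u hu => ?_) (ae_iff.1 h2))
  have h5 : tiltMass (marksLaw ν) (residualReal α) u ≠ 0 := by
    refine tiltMass_ne_zero (measurable_residualReal α) fun h6 => h (measure_mono_null ?_ h6)
    intro ξ hξ
    exact lt_trans (show residualReal α ξ < x from hξ) hu.1
  simp only [Set.mem_ofPred_eq, Classical.not_imp]
  refine ⟨hx.trans hu.1, ?_⟩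
  rw [extinctionDensity, ofReal_tiltDensity]
  simp [hu.2, h5, Real.exp_pos]

/-- Start from some level that the lifetime can stay below and iterate: passing to the residual time
and back to the lifetime shrinks the level by a fixed factor below 1. -/
lemma measure_residualReal_lt_ne_zero (hα : α < 0)
    (hν : ν {s | (s : ℕ → ℝ) = Pi.single 0 1} = 0) {x : ℝ} (hx : 0 < x) :
    marksLaw ν {ξ | residualReal α ξ < x} ≠ 0 := by
  obtain ⟨c, hc0, hc1, hc⟩ := exists_ratio (ν := ν) hα hν
  -- A factor strictly above `c` leaves room for the strict inequalities in each pass from lifetime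
  -- to residual time and back.
  obtain ⟨d, hcd, hd1⟩ := exists_between hc1
  have hd0 : 0 < d := hc0.trans hcd
  obtain ⟨y, hy, hpy⟩ : ∃ y : ℝ, 0 < y ∧ marksLaw ν {ξ | lifetime α ξ < ENNReal.ofReal y} ≠ 0 := by
    by_contra! h
    have h1 : ∀ n : ℕ, ∀ᵐ ξ ∂marksLaw ν, ¬ lifetime α ξ < ENNReal.ofReal ((n : ℝ) + 1) := by
      intro n
      rw [ae_iff]; simpa using h ((n : ℝ) + 1) (by positivity)
    obtain ⟨ξ, h2, h3⟩ := ((ae_all_iff.2 h1).and (ae_lifetime_lt_top hα hν)).exists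
    obtain ⟨n, hn⟩ := exists_nat_gt (lifetime α ξ).toReal
    refine h2 n ((ENNReal.lt_ofReal_iff_toReal_lt h3.ne).2 (hn.trans (lt_add_one _)))
  have hstep : ∀ n : ℕ, marksLaw ν {ξ | lifetime α ξ < ENNReal.ofReal (d ^ n * y)} ≠ 0 := by
    intro n
    induction n with
    | zero => simpa using hpy
    | succ n ih =>
      have hyn : 0 < d ^ n * y := by positivity
      obtain ⟨x, hx1, hx2⟩ := exists_between (mul_lt_mul_of_pos_right hcd hyn)
      have h1 := measure_residualReal_lt_ne_zero_of_ratio hα hν hc0 hyn hc ih hx1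
      refine measure_lifetime_lt_ne_zero_of_residual hα hν ((mul_pos hc0 hyn).trans hx1) h1 ?_
      rwa [pow_succ', mul_assoc]
  obtain ⟨n, hn⟩ := exists_pow_lt_of_lt_one (div_pos hx hy) hd1
  rw [lt_div_iff₀ hy] at hn
  refine measure_residualReal_lt_ne_zero_of_ratio hα hν hc0 (by positivity) hc (hstep n) ?_
  refine lt_trans ?_ hn
  have : 0 < d ^ n * y := by positivity
  nlinarith

lemma tiltMass_residualReal_ne_zero (hα : α < 0)
    (hν : ν {s | (s : ℕ → ℝ) = Pi.single 0 1} = 0) (x : ℝ) (hx : 0 < x) :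
    tiltMass (marksLaw ν) (residualReal α) x ≠ 0 :=
  tiltMass_ne_zero (measurable_residualReal α) (measure_residualReal_lt_ne_zero hα hν hx)

lemma extinctionDensity_pos (hα : α < 0)
    (hν : ν {s | (s : ℕ → ℝ) = Pi.single 0 1} = 0) {x : ℝ} (hx : 0 < x) :
    0 < extinctionDensity α ν x :=
  mul_pos (Real.exp_pos _) (ENNReal.toReal_pos (tiltMass_residualReal_ne_zero hα hν x hx)
    (ne_top_of_le_ne_top ENNReal.ofReal_ne_top (tiltMass_le x)))

lemma continuousOn_extinctionDensity (hα : α < 0)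
    (hν : ν {s | (s : ℕ → ℝ) = Pi.single 0 1} = 0) :
    ContinuousOn (extinctionDensity α ν) (Set.Ioi 0) :=
  continuousOn_tiltDensity (measurable_residualReal α) fun _ hx => measure_residualReal_eq hα hν hx

end

/-! ### Genealogy: self-similarity, presence of blocks and death times. -/

section

variable {α : ℝ} {ξ : Marks}

lemma mass_nonneg (ξ : Marks) (u : List ℕ) : 0 ≤ mass ξ u := by
  induction u with
  | nil => exact zero_le_one
  | cons i u ih => exact mul_nonneg ih ((ξ u).2.2.2.1 i)

lemma mass_le_one (ξ : Marks) (u : List ℕ) : mass ξ u ≤ 1 := by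
  induction u with
  | nil => exact le_rfl
  | cons i u ih =>
    exact mul_le_one₀ ih ((ξ u).2.2.2.1 i) (le_hasSum (ξ u).2.2.2.2 i fun j _ => (ξ u).2.2.2.1 j)

lemma mass_cons (ξ : Marks) (i : ℕ) (u : List ℕ) :
    mass ξ (i :: u) = mass ξ u * part (subtree u ξ) i := by
  simp [mass, part, subtree]

lemma mass_append (ξ : Marks) (u v : List ℕ) :
    mass ξ (v ++ u) = mass ξ u * mass (subtree u ξ) v := by
  induction v with
  | nil => simp [mass]
  | cons i v ih =>
    rw [List.cons_append, mass_cons, ih, mass_cons, subtree_subtree, mul_assoc]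

/-- Self-similarity in the tree: masses multiply along lineages, so times below `u` are those of its
subtree scaled by `mass ξ u ^ (-α)`. -/
lemma birth_append (α : ℝ) (ξ : Marks) (u v : List ℕ) :
    birth α ξ (v ++ u) = birth α ξ u + mass ξ u ^ (-α) * birth α (subtree u ξ) v := by
  induction v with
  | nil => simp [birth]
  | cons i v ih =>
    rw [List.cons_append, birth, birth, ih, mass_append,
      Real.mul_rpow (mass_nonneg _ _) (mass_nonneg _ _)]
    simp only [subtree]
    ring

lemma splitTime_append (α : ℝ) (ξ : Marks) (u v : List ℕ) :
    splitTime α ξ (v ++ u) = birth α ξ u + mass ξ u ^ (-α) * splitTime α (subtree u ξ) v :=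
  -- A block splits when its sub-blocks are born; the rank `0` is an arbitrary choice.
  birth_append α ξ u (0 :: v)

lemma birth_cons (α : ℝ) (ξ : Marks) (i : ℕ) (u : List ℕ) :
    birth α ξ (i :: u) = splitTime α ξ u := rfl

/-- All the clocks are positive. -/
def PositiveClocks (ξ : Marks) : Prop := ∀ u, 0 < (ξ u).1

lemma PositiveClocks.subtree (h : PositiveClocks ξ) (u : List ℕ) :
    PositiveClocks (subtree u ξ) := fun v => h (v ++ u)

lemma birth_le_splitTime (h : PositiveClocks ξ) (u : List ℕ) : birth α ξ u ≤ splitTime α ξ u :=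
  le_add_of_nonneg_right (mul_nonneg (Real.rpow_nonneg (mass_nonneg _ _) _) (h u).le)

lemma birth_nonneg (h : PositiveClocks ξ) (u : List ℕ) : 0 ≤ birth α ξ u := by
  induction u with
  | nil => exact le_rfl
  | cons i u ih => exact ih.trans (birth_le_splitTime h u)

lemma birth_mono (h : PositiveClocks ξ) (u v : List ℕ) : birth α ξ u ≤ birth α ξ (v ++ u) := by
  rw [birth_append]
  exact le_add_of_nonneg_right (mul_nonneg (Real.rpow_nonneg (mass_nonneg _ _) _)
    (birth_nonneg (h.subtree u) v))

lemma mass_pos_of_present (hα : α < 0) {u : List ℕ} {t : ℝ} (h : Present α ξ u t) :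
    0 < mass ξ u := by
  refine lt_of_le_of_ne (mass_nonneg ξ u) fun h0 => ?_
  have := h.1.trans_lt h.2
  rw [splitTime, ← h0, Real.zero_rpow (by linarith)] at this
  simp at this

lemma present_append {u v : List ℕ} {t : ℝ} (hu : 0 < mass ξ u) :
    Present α ξ (v ++ u) t ↔
      Present α (subtree u ξ) v ((t - birth α ξ u) / mass ξ u ^ (-α)) := by
  have hm : 0 < mass ξ u ^ (-α) := Real.rpow_pos_of_pos hu _
  rw [Present, Present, birth_append, splitTime_append, le_div_iff₀ hm, div_lt_iff₀ hm,
    mul_comm (birth _ _ _), mul_comm (splitTime _ _ _)]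
  constructor <;> rintro ⟨h1, h2⟩ <;> constructor <;> linarith

lemma mass_singleton (ξ : Marks) (i : ℕ) : mass ξ [i] = part ξ i := by
  simp [mass, part]

/-- The recursion for the lifetime peels off the oldest ancestor, which sits at the end of the
label; hence the induction from the right. -/
lemma ofReal_splitTime_le_lifetime (h : PositiveClocks ξ) (u : List ℕ) :
    ENNReal.ofReal (splitTime α ξ u) ≤ lifetime α ξ := by
  induction u using List.reverseRecOn generalizing ξ with
  | nil =>
    rw [lifetime_eq]
    refine le_trans (ENNReal.ofReal_le_ofReal ?_) le_self_add
    simp [splitTime, birth, mass]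
  | append_singleton v i ih =>
    rw [splitTime_append, lifetime_eq, mass_singleton]
    refine (ENNReal.ofReal_add_le).trans (add_le_add (ENNReal.ofReal_le_ofReal ?_) ?_)
    · simp [birth, mass]
    · rw [ENNReal.ofReal_mul (Real.rpow_nonneg (part_nonneg ξ i) _)]
      refine le_trans (mul_le_mul' le_rfl (ih (h.subtree [i]))) ?_
      exact le_iSup (fun i => ENNReal.ofReal (part ξ i ^ (-α)) * lifetime α (subtree [i] ξ)) i

/-- Before the first split the initial block is present. Afterwards some sub-block has a truncated
lifetime exceeding the rescaled elapsed time, and the search continues in its subtree. -/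
lemma exists_present_of_lt_truncatedLifetime (hα : α < 0) (h : PositiveClocks ξ) (n : ℕ) {t : ℝ}
    (ht : 0 ≤ t) (hlt : ENNReal.ofReal t < truncatedLifetime α n ξ) : ∃ u, Present α ξ u t := by
  induction n generalizing ξ t with
  | zero => simp [truncatedLifetime] at hlt
  | succ n ih =>
    rcases lt_or_ge t (ξ []).1 with h1 | h1
    · exact ⟨[], by simpa [Present, splitTime, birth, mass] using ⟨ht, h1⟩⟩
    · have hc := h []
      have h2 : ENNReal.ofReal (t - (ξ []).1) <
          ⨆ i, ENNReal.ofReal (part ξ i ^ (-α)) * truncatedLifetime α n (subtree [i] ξ) := by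
        rw [ENNReal.ofReal_sub _ hc.le]
        exact ENNReal.sub_lt_of_lt_add (ENNReal.ofReal_le_ofReal h1) (by rwa [add_comm])
      obtain ⟨i, hi⟩ := lt_iSup_iff.1 h2
      have hpos : 0 < part ξ i ^ (-α) := by
        by_contra hn
        rw [ENNReal.ofReal_of_nonpos (not_lt.1 hn), zero_mul] at hi
        exact not_lt_zero hi
      have hpart : 0 < part ξ i := by
        refine lt_of_le_of_ne (part_nonneg ξ i) fun h0 => ?_
        rw [← h0, Real.zero_rpow (by linarith)] at hpos
        exact lt_irrefl _ hpos
      obtain ⟨v, hv⟩ := ih (h.subtree [i]) (t := (t - (ξ []).1) / part ξ i ^ (-α))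
        (div_nonneg (sub_nonneg.2 h1) hpos.le) (by
          rw [ENNReal.ofReal_div_of_pos hpos]
          exact ENNReal.div_lt_of_lt_mul' hi)
      refine ⟨v ++ [i], (present_append (by rwa [mass_singleton])).2 ?_⟩
      simpa [birth, mass, part] using hv

lemma exists_present_iff (hα : α < 0) (h : PositiveClocks ξ) {t : ℝ} (ht : 0 ≤ t) :
    (∃ u, Present α ξ u t) ↔ ENNReal.ofReal t < lifetime α ξ := by
  constructor
  · rintro ⟨u, hu⟩
    refine lt_of_lt_of_le ?_ (ofReal_splitTime_le_lifetime h u)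
    exact (ENNReal.ofReal_lt_ofReal_iff_of_nonneg ht).2 hu.2
  · intro hlt
    obtain ⟨n, hn⟩ := lt_iSup_iff.1 hlt
    exact exists_present_of_lt_truncatedLifetime hα h n ht hn

/-- The term of rank 0 dominates every member. The bound by 1 keeps the suprema from taking the
default value of an unbounded set, and the infinite index set puts 0 in each of the sets. -/
lemma decreasingRearrangement_eq_zero_iff {ι : Type*} [Infinite ι] {a : ι → ℝ} (h0 : ∀ i, 0 ≤ a i)
    (h1 : ∀ i, a i ≤ 1) : decreasingRearrangement a = 0 ↔ ∀ i, a i = 0 := by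
  have hbdd (n : ℕ) : BddAbove {x : ℝ | ((n + 1 : ℕ) : ℕ∞) ≤ {i | x ≤ a i}.encard} := by
    refine ⟨1, fun x hx => ?_⟩
    have hne : {i | x ≤ a i}.Nonempty := by
      rw [← Set.encard_ne_zero]
      rintro h0
      rw [Set.mem_ofPred_eq, h0] at hx
      simp at hx
    obtain ⟨i, hi⟩ := hne
    exact le_trans hi (h1 i)
  constructor
  · intro h i
    refine le_antisymm ?_ (h0 i)
    have h2 := congrFun h 0
    rw [decreasingRearrangement] at h2
    refine (le_csSup (hbdd 0) ?_).trans_eq h2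
    rw [Set.mem_ofPred_eq]
    simp only [zero_add, Nat.cast_one, Set.one_le_encard_iff_nonempty]
    exact ⟨i, le_refl (a i)⟩
  · intro h
    ext n
    rw [decreasingRearrangement]
    refine le_antisymm (csSup_le ⟨0, ?_⟩ fun x hx => ?_) (le_csSup (hbdd n) ?_)
    · simp [h]
    · by_contra hlt
      have : {i | x ≤ a i} = ∅ := by
        ext i; simpa [h] using hlt
      rw [Set.mem_ofPred_eq, this] at hx
      simp at hx
    · simp [h]

lemma fragmentsOf_eq_zero_iff (hα : α < 0) {u : List ℕ} {t : ℝ} :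
    fragmentsOf α ξ u t = 0 ↔ ∀ v, u <:+ v → ¬ Present α ξ v t := by
  rw [fragmentsOf, decreasingRearrangement_eq_zero_iff]
  · refine forall_congr' fun v => ?_
    constructor
    · intro h hs hp
      rw [if_pos ⟨hs, hp⟩] at h
      exact (mass_pos_of_present hα hp).ne' h
    · intro h
      exact if_neg fun ⟨hs, hp⟩ => h hs hp
  · intro v; split_ifs; exacts [mass_nonneg ξ v, le_rfl]
  · intro v; split_ifs; exacts [mass_le_one ξ v, zero_le_one]

/-- The time at which the last descendant of the block `u` disappears. -/
def deathTime (α : ℝ) (ξ : Marks) (u : List ℕ) : ℝ :=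
  birth α ξ u + mass ξ u ^ (-α) * lifetimeReal α (subtree u ξ)

lemma fragmentsOf_eq_zero_iff_deathTime_le (hα : α < 0) (h : PositiveClocks ξ) {u : List ℕ} {t : ℝ}
    (hu : 0 < mass ξ u) (hfin : lifetime α (subtree u ξ) < ∞) (ht : birth α ξ u ≤ t) :
    fragmentsOf α ξ u t = 0 ↔ deathTime α ξ u ≤ t := by
  have hm : 0 < mass ξ u ^ (-α) := Real.rpow_pos_of_pos hu _
  have h0 : 0 ≤ (t - birth α ξ u) / mass ξ u ^ (-α) := div_nonneg (sub_nonneg.2 ht) hm.le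
  have key := (exists_present_iff hα (h.subtree u) h0).not
  rw [fragmentsOf_eq_zero_iff hα, deathTime]
  calc (∀ v, u <:+ v → ¬ Present α ξ v t) ↔
        ¬ ∃ w, Present α (subtree u ξ) w ((t - birth α ξ u) / mass ξ u ^ (-α)) := by
        push Not
        constructor
        · intro hv w; rw [← present_append hu]; exact hv _ (List.suffix_append w u)
        · rintro hw v ⟨w, rfl⟩; rw [present_append hu]; exact hw w
    _ ↔ _ := by
        rw [key, not_lt, ENNReal.le_ofReal_iff_toReal_le hfin.ne h0, le_div_iff₀ hm, lifetimeReal,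
          mul_comm]
        constructor <;> intro <;> linarith

lemma residualExtinctionTime_eq (hα : α < 0) (h : PositiveClocks ξ) {u : List ℕ} {t : ℝ}
    (hu : 0 < mass ξ u) (hfin : lifetime α (subtree u ξ) < ∞) (ht : birth α ξ u ≤ t)
    (ht' : t ≤ deathTime α ξ u) : residualExtinctionTime α ξ u t = deathTime α ξ u - t := by
  have : {s | 0 ≤ s ∧ fragmentsOf α ξ u (t + s) = 0} = Set.Ici (deathTime α ξ u - t) := by
    ext s
    simp only [Set.mem_ofPred_eq, Set.mem_Ici]
    constructor
    · rintro ⟨hs, h1⟩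
      rw [fragmentsOf_eq_zero_iff_deathTime_le hα h hu hfin (by linarith)] at h1
      linarith
    · intro hs
      have hs0 : 0 ≤ s := by linarith
      refine ⟨hs0, ?_⟩
      rw [fragmentsOf_eq_zero_iff_deathTime_le hα h hu hfin (by linarith)]
      linarith
  rw [residualExtinctionTime, this, csInf_Ici]

lemma deathTime_nil (α : ℝ) (ξ : Marks) : deathTime α ξ [] = lifetimeReal α ξ := by
  simp [deathTime, birth, mass]

lemma extinctionTime_eq (hα : α < 0) (h : PositiveClocks ξ) (hfin : lifetime α ξ < ∞) :
    extinctionTime α ξ = lifetimeReal α ξ := by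
  have h1 := residualExtinctionTime_eq hα h (u := []) (t := 0) (by simp [mass]) (by simpa)
    (by simp [birth]) (by rw [deathTime_nil]; exact lifetimeReal_nonneg α ξ)
  rw [deathTime_nil, sub_zero] at h1
  rw [← h1, extinctionTime, residualExtinctionTime]
  simp [fragmentation]

lemma splitTime_le_deathTime (h : PositiveClocks ξ) {u : List ℕ}
    (hfin : lifetime α (subtree u ξ) < ∞) : splitTime α ξ u ≤ deathTime α ξ u := by
  have h1 := ofReal_splitTime_le_lifetime (α := α) (h.subtree u) []
  have h2 : splitTime α (subtree u ξ) [] = (ξ u).1 := by simp [splitTime, birth, mass, subtree]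
  rw [h2, ENNReal.ofReal_le_iff_le_toReal hfin.ne] at h1
  exact add_le_add le_rfl (mul_le_mul_of_nonneg_left h1 (Real.rpow_nonneg (mass_nonneg _ _) _))

lemma deathTime_cons {u : List ℕ} (i : ℕ) :
    deathTime α ξ (i :: u) = splitTime α ξ u + mass ξ u ^ (-α) * branch α (subtree u ξ) i := by
  rw [deathTime, birth_cons, mass_cons, Real.mul_rpow (mass_nonneg _ _) (part_nonneg _ _), branch,
    ← subtree_cons, mul_assoc]

end

/-! ### Regular marks, the spine and the last fragment. -/

section

variable {α : ℝ} {ξ : Marks}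

/-- The almost sure properties of the marks of the initial block and of its descendants. -/
structure Regular (α : ℝ) (ξ : Marks) : Prop where
  clock_pos : 0 < (ξ []).1
  lifetime_lt_top : lifetime α ξ < ∞
  part_zero_lt_one : part ξ 0 < 1
  tsum_lt_top : ∑' n, generationSum α n ξ < ∞
  no_tie : ∀ i j, i ≠ j → branch α ξ i = branch α ξ j → branch α ξ j = 0

/-- The marks of the descendants of each block are regular. -/
def Good (α : ℝ) (ξ : Marks) : Prop := ∀ u, Regular α (subtree u ξ)

lemma Good.subtree (h : Good α ξ) (u : List ℕ) : Good α (subtree u ξ) := fun v => by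
  rw [subtree_subtree]; exact h _

lemma Good.regular (h : Good α ξ) : Regular α ξ := by simpa using h []

lemma Good.positiveClocks (h : Good α ξ) : PositiveClocks ξ := fun u => by
  simpa [Fragmentation.subtree] using (h u).clock_pos

lemma ae_good {ν : Measure massPartitions} [IsProbabilityMeasure ν] (hα : α < 0)
    (hν : ν {s | (s : ℕ → ℝ) = Pi.single 0 1} = 0) : ∀ᵐ ξ ∂marksLaw ν, Good α ξ := by
  have : ∀ᵐ ξ ∂marksLaw ν, Regular α ξ := by
    filter_upwards [ae_root_clock_pos ν, ae_lifetime_lt_top hα hν, ae_part_zero_lt_one hν,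
      ae_tsum_generationSum_lt_top hα hν, ae_branch_eq_branch_imp hα hν] with ξ h1 h2 h3 h4 h5
    exact ⟨h1, h2, h3, h4, h5⟩
  exact ae_all_iff.2 fun u => (measurePreserving_subtree ν u).quasiMeasurePreserving.ae this

/-- The rank of the sub-block of the initial block that becomes extinct last. -/
def lastChild (α : ℝ) (ξ : Marks) : ℕ := sInf {i | residualReal α ξ ≤ branch α ξ i}

/-- The successive labels of the last block. -/
def spine (α : ℝ) (ξ : Marks) : ℕ → List ℕ
  | 0 => []
  | n + 1 => lastChild α (subtree (spine α ξ n) ξ) :: spine α ξ n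

lemma Regular.branch_le (h : Regular α ξ) (i : ℕ) : branch α ξ i ≤ residualReal α ξ := by
  rw [branch_eq_toReal]
  exact ENNReal.toReal_mono (residualLifetime_lt_top h.lifetime_lt_top).ne
    (le_iSup (fun i => ENNReal.ofReal (part ξ i ^ (-α)) * lifetime α
      (Fragmentation.subtree [i] ξ)) i)

lemma Regular.branch_lastChild (hα : α < 0) (h : Regular α ξ) :
    branch α ξ (lastChild α ξ) = residualReal α ξ := by
  have hne : {i | residualReal α ξ ≤ branch α ξ i}.Nonempty := by
    obtain ⟨i, hi⟩ := exists_branch_eq hα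
      ((ENNReal.le_tsum (f := fun n => generationSum α n ξ) 1).trans_lt h.tsum_lt_top)
    refine ⟨i, show residualReal α ξ ≤ branch α ξ i from le_of_eq ?_⟩
    rw [branch_eq_toReal, hi, residualReal]
  exact le_antisymm (h.branch_le _) (Nat.sInf_mem hne)

lemma part_zero_pos (ξ : Marks) : 0 < part ξ 0 := by
  refine lt_of_le_of_ne (part_nonneg ξ 0) fun h0 => ?_
  have hz : ∀ i, ((ξ []).2 : ℕ → ℝ) i = 0 := fun i =>
    le_antisymm (((ξ []).2.2.1 (Nat.zero_le i)).trans h0.symm.le) ((ξ []).2.2.2.1 i)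
  have := (ξ []).2.2.2.2
  rw [show ((ξ []).2 : ℕ → ℝ) = fun _ => 0 from funext hz] at this
  exact zero_ne_one (hasSum_zero.unique this)

lemma Regular.lifetimeReal_eq (h : Regular α ξ) :
    lifetimeReal α ξ = (ξ []).1 + residualReal α ξ :=
  Fragmentation.lifetimeReal_eq h.clock_pos h.lifetime_lt_top

lemma Regular.lifetimeReal_pos (h : Regular α ξ) : 0 < lifetimeReal α ξ := by
  rw [h.lifetimeReal_eq]
  exact add_pos_of_pos_of_nonneg h.clock_pos (residualReal_nonneg α ξ)

lemma Good.residualReal_pos (h : Good α ξ) : 0 < residualReal α ξ :=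
  lt_of_lt_of_le (mul_pos (Real.rpow_pos_of_pos (part_zero_pos ξ) _) (h [0]).lifetimeReal_pos)
    (h.regular.branch_le 0)

/-- A tie is only possible at the value 0, and the residual time is positive. -/
lemma Good.branch_lt (hα : α < 0) (h : Good α ξ) {i : ℕ} (hi : i ≠ lastChild α ξ) :
    branch α ξ i < residualReal α ξ := by
  refine lt_of_le_of_ne (h.regular.branch_le i) fun heq => ?_
  have h1 := h.regular.branch_lastChild hα
  have h2 := h.regular.no_tie _ _ hi (heq.trans h1.symm)
  exact h.residualReal_pos.ne' (h1.symm.trans h2)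

lemma Good.part_lastChild_pos (hα : α < 0) (h : Good α ξ) : 0 < part ξ (lastChild α ξ) := by
  refine lt_of_le_of_ne (part_nonneg ξ _) fun h0 => h.residualReal_pos.ne' ?_
  rw [← h.regular.branch_lastChild hα, branch, ← h0, Real.zero_rpow (by linarith), zero_mul]

lemma Good.part_lt_one (h : Good α ξ) (i : ℕ) : part ξ i < 1 :=
  ((ξ []).2.2.1 (Nat.zero_le i)).trans_lt h.regular.part_zero_lt_one

lemma spine_succ (α : ℝ) (ξ : Marks) (n : ℕ) :
    spine α ξ (n + 1) = lastChild α (subtree (spine α ξ n) ξ) :: spine α ξ n := rfl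

lemma Good.mass_spine_pos (hα : α < 0) (h : Good α ξ) (n : ℕ) : 0 < mass ξ (spine α ξ n) := by
  induction n with
  | zero => simp [spine, mass]
  | succ n ih => rw [spine_succ, mass_cons]; exact mul_pos ih ((h.subtree _).part_lastChild_pos hα)

lemma Good.mass_spine_succ_lt (hα : α < 0) (h : Good α ξ) (n : ℕ) :
    mass ξ (spine α ξ (n + 1)) < mass ξ (spine α ξ n) := by
  rw [spine_succ, mass_cons]
  exact mul_lt_of_lt_one_right (h.mass_spine_pos hα n) ((h.subtree _).part_lt_one _)

lemma Good.splitTime_add (h : Good α ξ) (u : List ℕ) :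
    splitTime α ξ u + mass ξ u ^ (-α) * residualReal α (Fragmentation.subtree u ξ) =
      deathTime α ξ u := by
  rw [deathTime, (h u).lifetimeReal_eq, splitTime]
  simp only [Fragmentation.subtree, List.nil_append]
  ring

/-- The last child attains the residual time, so the death time is preserved at each step along the
spine. -/
lemma Good.deathTime_spine (hα : α < 0) (h : Good α ξ) (n : ℕ) :
    deathTime α ξ (spine α ξ n) = lifetimeReal α ξ := by
  induction n with
  | zero => exact deathTime_nil α ξ
  | succ n ih =>
    rw [spine_succ, deathTime_cons, (h _).branch_lastChild hα, h.splitTime_add, ih]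

lemma Good.deathTime_append_le (h : Good α ξ) (u v : List ℕ) :
    deathTime α ξ (v ++ u) ≤ deathTime α ξ u := by
  induction v with
  | nil => exact le_rfl
  | cons i v ih =>
    rw [List.cons_append, deathTime_cons]
    refine le_trans ?_ ih
    rw [← h.splitTime_add]
    gcongr
    · exact Real.rpow_nonneg (mass_nonneg _ _) _
    · exact (h _).branch_le i

lemma Good.deathTime_lt (hα : α < 0) (h : Good α ξ) (n i : ℕ) (v : List ℕ)
    (hi : i ≠ lastChild α (Fragmentation.subtree (spine α ξ n) ξ)) :
    deathTime α ξ (v ++ i :: spine α ξ n) < lifetimeReal α ξ := by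
  refine (h.deathTime_append_le _ v).trans_lt ?_
  rw [deathTime_cons, ← h.deathTime_spine hα n, ← h.splitTime_add]
  have := Real.rpow_pos_of_pos (h.mass_spine_pos hα n) (-α)
  gcongr
  exact (h.subtree _).branch_lt hα hi

lemma eq_or_exists_of_suffix {u v : List ℕ} (h : u <:+ v) : v = u ∨ ∃ w i, v = w ++ i :: u := by
  obtain ⟨w, rfl⟩ := h
  rcases List.eq_nil_or_concat w with rfl | ⟨w', i, rfl⟩
  · exact Or.inl rfl
  · exact Or.inr ⟨w', i, by simp⟩

/-- A label that is neither an earlier spine block nor below the `n`-th one has left the spine at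
some rank other than the last child, which costs strictly in death time. -/
lemma Good.spine_trichotomy (hα : α < 0) (h : Good α ξ) (n : ℕ) (v : List ℕ) :
    spine α ξ n <:+ v ∨ (∃ k < n, v = spine α ξ k) ∨ deathTime α ξ v < lifetimeReal α ξ := by
  induction n with
  | zero => exact Or.inl List.nil_suffix
  | succ n ih =>
    rcases ih with h1 | ⟨k, hk, h1⟩ | h1
    · rcases eq_or_exists_of_suffix h1 with rfl | ⟨w, i, rfl⟩
      · exact Or.inr (Or.inl ⟨n, by omega, rfl⟩)
      · by_cases hi : i = lastChild α (Fragmentation.subtree (spine α ξ n) ξ)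
        · left; rw [spine_succ, ← hi]; exact List.suffix_append _ _
        · exact Or.inr (Or.inr (h.deathTime_lt hα n i w hi))
    · exact Or.inr (Or.inl ⟨k, by omega, h1⟩)
    · exact Or.inr (Or.inr h1)

/-- The contribution of the descendants of a single block is part of the corresponding generation
sum. -/
lemma mass_rpow_mul_generationSum_le (m : ℕ) (u : List ℕ) :
    ENNReal.ofReal (mass ξ u ^ (1 - α)) * generationSum α m (subtree u ξ) ≤
      generationSum α (m + u.length) ξ := by
  induction u generalizing m with
  | nil => simp [mass]
  | cons i u ih =>
    refine le_trans ?_ ((ih (m + 1)).trans_eq (by rw [List.length_cons]; congr 1; omega))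
    rw [mass_cons, Real.mul_rpow (mass_nonneg _ _) (part_nonneg _ _),
      ENNReal.ofReal_mul (Real.rpow_nonneg (mass_nonneg _ _) _), mul_assoc, subtree_cons]
    gcongr
    exact ENNReal.le_tsum (f := fun i => ENNReal.ofReal (part (subtree u ξ) i ^ (1 - α)) *
      generationSum α m (subtree [i] (subtree u ξ))) i

lemma length_spine (n : ℕ) : (spine α ξ n).length = n := by
  induction n with
  | zero => rfl
  | succ n ih => rw [spine_succ, List.length_cons, ih]

/-- The p-th power of the time left at the `n`-th spine block is one term of the `n`-th generation
sum, which tends to 0. So the spine births do not accumulate before extinction. -/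
lemma Good.tendsto_birth_spine (hα : α < 0) (h : Good α ξ) :
    Filter.Tendsto (fun n => birth α ξ (spine α ξ n)) Filter.atTop (nhds (lifetimeReal α ξ)) := by
  have hp : 0 < 1 - α⁻¹ := by have := inv_lt_zero.2 hα; linarith
  set g : ℕ → ℝ≥0∞ := fun n => ENNReal.ofReal (mass ξ (spine α ξ n) ^ (-α)) *
    lifetime α (Fragmentation.subtree (spine α ξ n) ξ) with hg
  have h1 : Filter.Tendsto (fun n => g n ^ (1 - α⁻¹)) Filter.atTop (nhds 0) := by
    refine tendsto_of_tendsto_of_tendsto_of_le_of_le tendsto_const_nhds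
      (ENNReal.tendsto_atTop_zero_of_tsum_ne_top h.regular.tsum_lt_top.ne) (fun _ => zero_le)
      fun n => ?_
    have := mass_rpow_mul_generationSum_le (α := α) (ξ := ξ) 0 (spine α ξ n)
    rw [length_spine, zero_add] at this
    refine le_trans (le_of_eq ?_) this
    simp only [hg]
    rw [ENNReal.mul_rpow_of_nonneg _ _ hp.le, ofReal_rpow_neg_rpow hα (mass_nonneg _ _)]
    rfl
  have h2 : Filter.Tendsto g Filter.atTop (nhds 0) := by
    have := h1.ennrpow_const (1 - α⁻¹)⁻¹
    simpa [ENNReal.rpow_rpow_inv hp.ne', hp] using this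
  have h3 := (ENNReal.tendsto_toReal ENNReal.zero_ne_top).comp h2
  have h4 : ∀ n, birth α ξ (spine α ξ n) = lifetimeReal α ξ - (g n).toReal := by
    intro n
    rw [← h.deathTime_spine hα n, deathTime, hg, ENNReal.toReal_mul, ENNReal.toReal_ofReal
      (Real.rpow_nonneg (mass_nonneg _ _) _), lifetimeReal]
    ring
  simp_rw [h4]
  simpa using h3.const_sub (lifetimeReal α ξ)

lemma Good.birth_spine_lt (hα : α < 0) (h : Good α ξ) (n : ℕ) :
    birth α ξ (spine α ξ n) < lifetimeReal α ξ := by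
  rw [← h.deathTime_spine hα n, deathTime]
  exact lt_add_of_pos_right _ (mul_pos (Real.rpow_pos_of_pos (h.mass_spine_pos hα n) _)
    (h _).lifetimeReal_pos)

lemma Good.monotone_birth_spine (h : Good α ξ) : Monotone fun n => birth α ξ (spine α ξ n) :=
  monotone_nat_of_le_succ fun _ => birth_le_splitTime h.positiveClocks _

lemma Good.birth_spine_lt_succ (hα : α < 0) (h : Good α ξ) (n : ℕ) :
    birth α ξ (spine α ξ n) < birth α ξ (spine α ξ (n + 1)) :=
  lt_add_of_pos_right _ (mul_pos (Real.rpow_pos_of_pos (h.mass_spine_pos hα n) _)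
    (h.positiveClocks _))

lemma Good.exists_birth_spine (hα : α < 0) (h : Good α ξ) {t : ℝ} (ht : 0 ≤ t)
    (ht' : t < lifetimeReal α ξ) :
    ∃ n, birth α ξ (spine α ξ n) ≤ t ∧ t < birth α ξ (spine α ξ (n + 1)) := by
  have hex : ∃ n, t < birth α ξ (spine α ξ n) :=
    ((h.tendsto_birth_spine hα).eventually (lt_mem_nhds ht')).exists
  classical
  obtain ⟨n, hn⟩ : ∃ n, Nat.find hex = n + 1 := by
    refine Nat.exists_eq_succ_of_ne_zero fun h0 => ?_
    have := Nat.find_spec hex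
    rw [h0] at this
    exact ht.not_gt this
  exact ⟨n, not_lt.1 (Nat.find_min hex (by omega)), hn ▸ Nat.find_spec hex⟩

lemma Good.residualExtinctionTime_eq (hα : α < 0) (h : Good α ξ) {u : List ℕ} {t : ℝ}
    (hu : Present α ξ u t) : residualExtinctionTime α ξ u t = deathTime α ξ u - t :=
  Fragmentation.residualExtinctionTime_eq hα h.positiveClocks (mass_pos_of_present hα hu)
    (h u).lifetime_lt_top hu.1
    (hu.2.le.trans (splitTime_le_deathTime h.positiveClocks (h u).lifetime_lt_top))

/-- At such a time the proper descendants of the spine block are unborn, the earlier spine blocks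
have split, and all blocks off the spine die strictly earlier. -/
lemma Good.isLastBlock_iff (hα : α < 0) (h : Good α ξ) {n : ℕ} {t : ℝ}
    (h1 : birth α ξ (spine α ξ n) ≤ t) (h2 : t < birth α ξ (spine α ξ (n + 1))) (u : List ℕ) :
    IsLastBlock α ξ t u ↔ u = spine α ξ n := by
  have hpres : Present α ξ (spine α ξ n) t := ⟨h1, h2⟩
  have hother : ∀ v, Present α ξ v t → v = spine α ξ n ∨ deathTime α ξ v < lifetimeReal α ξ := by
    intro v hv
    rcases h.spine_trichotomy hα n v with h3 | ⟨k, hk, rfl⟩ | h3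
    · rcases eq_or_exists_of_suffix h3 with rfl | ⟨w, i, rfl⟩
      · exact Or.inl rfl
      · have := (birth_mono h.positiveClocks (i :: spine α ξ n) w).trans hv.1
        exact absurd h2 (not_lt.2 this)
    · have h4 : birth α ξ (spine α ξ (k + 1)) ≤ birth α ξ (spine α ξ n) :=
        h.monotone_birth_spine hk
      exact absurd (h4.trans h1) (not_le.2 hv.2)
    · exact Or.inr h3
  constructor
  · rintro ⟨h3, h4⟩
    rcases hother u h3 with h5 | h5
    · exact h5
    · have := h4 _ hpres
      rw [h.residualExtinctionTime_eq hα hpres, h.residualExtinctionTime_eq hα h3,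
        h.deathTime_spine hα] at this
      linarith
  · rintro rfl
    refine ⟨hpres, fun v hv => ?_⟩
    rw [h.residualExtinctionTime_eq hα hpres, h.residualExtinctionTime_eq hα hv,
        h.deathTime_spine hα]
    rcases hother v hv with rfl | h5
    · rw [h.deathTime_spine hα]
    · linarith

lemma Good.extinctionTime_eq (hα : α < 0) (h : Good α ξ) :
    extinctionTime α ξ = lifetimeReal α ξ :=
  Fragmentation.extinctionTime_eq hα h.positiveClocks h.regular.lifetime_lt_top

lemma Good.hasLastFragment (hα : α < 0) (h : Good α ξ) : HasLastFragment α ξ := by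
  intro t ht ht'
  rw [h.extinctionTime_eq hα] at ht'
  obtain ⟨n, h1, h2⟩ := h.exists_birth_spine hα ht ht'
  exact ⟨spine α ξ n, (h.isLastBlock_iff hα h1 h2 _).2 rfl,
    fun v hv => (h.isLastBlock_iff hα h1 h2 _).1 hv⟩

lemma Good.lastBlock_eq (hα : α < 0) (h : Good α ξ) {n : ℕ} {t : ℝ}
    (h1 : birth α ξ (spine α ξ n) ≤ t) (h2 : t < birth α ξ (spine α ξ (n + 1))) :
    lastBlock α ξ t = spine α ξ n := by
  have hex : ∃ u, IsLastBlock α ξ t u := ⟨_, (h.isLastBlock_iff hα h1 h2 _).2 rfl⟩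
  rw [lastBlock, dif_pos hex]
  exact (h.isLastBlock_iff hα h1 h2 _).1 hex.choose_spec

lemma Good.lastFragment_eq (hα : α < 0) (h : Good α ξ) {n : ℕ} {t : ℝ}
    (h1 : birth α ξ (spine α ξ n) ≤ t) (h2 : t < birth α ξ (spine α ξ (n + 1))) :
    lastFragment α ξ t = mass ξ (spine α ξ n) := by
  have ht : t < extinctionTime α ξ := by
    rw [h.extinctionTime_eq hα]
    exact h2.trans (h.birth_spine_lt hα _)
  rw [lastFragment, if_pos ⟨h.hasLastFragment hα, ht⟩, h.lastBlock_eq hα h1 h2]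

lemma Good.lastFragment_birth (hα : α < 0) (h : Good α ξ) (n : ℕ) :
    lastFragment α ξ (birth α ξ (spine α ξ n)) = mass ξ (spine α ξ n) :=
  h.lastFragment_eq hα le_rfl (h.birth_spine_lt_succ hα n)

/-- The last fragment is constant between consecutive spine births and drops strictly at each of
them, because every relative mass is below 1; the infimum is thus attained. -/
lemma Good.jumpTime_eq (hα : α < 0) (h : Good α ξ) (n : ℕ) :
    jumpTime α ξ n = birth α ξ (spine α ξ n) := by
  induction n with
  | zero => rfl
  | succ n ih =>
    rw [jumpTime, ih, h.lastFragment_birth hα]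
    refine IsLeast.csInf_eq ⟨⟨(h.birth_spine_lt_succ hα n).le, ?_⟩, ?_⟩
    · rw [h.lastFragment_birth hα]
      exact h.mass_spine_succ_lt hα n
    · rintro t ⟨h1, h2⟩
      by_contra hlt
      rw [h.lastFragment_eq hα h1 (not_le.1 hlt)] at h2
      exact lt_irrefl _ h2

lemma Good.lastFragment_jumpTime (hα : α < 0) (h : Good α ξ) (n : ℕ) :
    lastFragment α ξ (jumpTime α ξ n) = mass ξ (spine α ξ n) := by
  rw [h.jumpTime_eq hα, h.lastFragment_birth hα]

lemma Good.lastBlock_jumpTime (hα : α < 0) (h : Good α ξ) (n : ℕ) :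
    lastBlock α ξ (jumpTime α ξ n) = spine α ξ n := by
  rw [h.jumpTime_eq hα]
  exact h.lastBlock_eq hα le_rfl (h.birth_spine_lt_succ hα n)

/-- The factor `F_* ^ α` cancels the time scale of the spine block. -/
lemma Good.Z_eq (hα : α < 0) (h : Good α ξ) (n : ℕ) :
    Z α ξ n = lifetimeReal α (Fragmentation.subtree (spine α ξ n) ξ) := by
  rw [Z, h.lastFragment_jumpTime hα, h.jumpTime_eq hα, h.extinctionTime_eq hα,
    ← h.deathTime_spine hα n, deathTime, add_sub_cancel_left, ← mul_assoc,
    ← Real.rpow_add (h.mass_spine_pos hα n), add_neg_cancel, Real.rpow_zero, one_mul]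

/-- The value of `(Z 1, Θ 1, Δ 1)`. -/
def firstStep (α : ℝ) (ξ : Marks) : ℝ × ℝ × (ℕ → ℝ) :=
  (lifetimeReal α (subtree [lastChild α ξ] ξ), part ξ (lastChild α ξ),
    removeTerm (part ξ) (lastChild α ξ))

/-- A measurable version of the process `(Z n, Θ n, Δ n)`. -/
def spineChain (α : ℝ) : ℕ → Marks → ℝ × ℝ × (ℕ → ℝ)
  | 0, ξ => (lifetimeReal α ξ, 1, 0)
  | n + 1, ξ => firstStep α (subtree (spine α ξ n) ξ)

lemma spineChain_fst (n : ℕ) :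
    (spineChain α n ξ).1 = lifetimeReal α (subtree (spine α ξ n) ξ) := by
  cases n with
  | zero => simp [spineChain, spine]
  | succ n => rw [spineChain, firstStep, spine_succ, subtree_cons _ (spine α ξ n)]

lemma Good.chain_eq (hα : α < 0) (h : Good α ξ) (n : ℕ) : chain α ξ n = spineChain α n ξ := by
  have hZ : Z α ξ n = (spineChain α n ξ).1 := by rw [h.Z_eq hα, spineChain_fst]
  rw [chain, hZ]
  cases n with
  | zero => rfl
  | succ n =>
    have hm := (h.mass_spine_pos hα n).ne'
    have hpart (k : ℕ) : mass ξ (k :: spine α ξ n) / mass ξ (spine α ξ n) =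
        part (Fragmentation.subtree (spine α ξ n) ξ) k := by
      rw [mass_cons, mul_div_cancel_left₀ _ hm]
    rw [Θ, Δ, h.lastFragment_jumpTime hα, h.lastFragment_jumpTime hα, h.lastBlock_jumpTime hα,
      h.lastBlock_jumpTime hα]
    simp only [spine_succ, hpart, List.headI_cons]
    rfl

end

/-! ### Conditioning on the extinction time, and the Markov property. -/

section

variable {α : ℝ} {ν : Measure massPartitions} [IsProbabilityMeasure ν]

lemma branch_setClock (e : ℝ) (ξ : Marks) (i : ℕ) :
    branch α (setClock e ξ) i = branch α ξ i := by
  simp [branch, part_setClock]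

lemma lastChild_setClock (e : ℝ) (ξ : Marks) : lastChild α (setClock e ξ) = lastChild α ξ := by
  simp [lastChild, branch_setClock, residualReal_setClock]

lemma firstStep_setClock (e : ℝ) (ξ : Marks) : firstStep α (setClock e ξ) = firstStep α ξ := by
  have : part (setClock e ξ) = part ξ := funext fun i => part_setClock e ξ i
  simp [firstStep, lastChild_setClock, this]

lemma measurable_lastChild : Measurable (lastChild α) := by
  refine measurable_to_countable' fun i => ?_
  have hm (j : ℕ) : MeasurableSet {ξ | residualReal α ξ ≤ branch α ξ j} :=
    measurableSet_le (by fun_prop) (by fun_prop)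
  -- If no branch attains the residual time, `sInf ∅ = 0`: this case belongs to the level set of `0`
  -- and accounts for the second piece.
  have : lastChild α ⁻¹' {i} =
      ({ξ | residualReal α ξ ≤ branch α ξ i} ∩
        ⋂ j, ⋂ (_ : j < i), {ξ | residualReal α ξ ≤ branch α ξ j}ᶜ)
      ∪ {ξ | i = 0 ∧ ξ ∈ ⋂ j, {ξ | residualReal α ξ ≤ branch α ξ j}ᶜ} := by
    ext ξ
    simp only [Set.mem_preimage, Set.mem_singleton_iff, Set.mem_union, Set.mem_inter_iff,
      Set.mem_ofPred_eq, Set.mem_iInter, Set.mem_compl_iff]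
    rcases Set.eq_empty_or_nonempty {i | residualReal α ξ ≤ branch α ξ i} with he | hne
    · have hall : ∀ j, ¬ residualReal α ξ ≤ branch α ξ j := fun j hj => by
        have : j ∈ {i | residualReal α ξ ≤ branch α ξ i} := hj
        rw [he] at this; exact this
      have h0 : lastChild α ξ = 0 := by rw [lastChild, he, Nat.sInf_empty]
      simp only [h0, hall, not_false_eq_true, implies_true, and_true, false_or]
      exact eq_comm
    · have hmem : residualReal α ξ ≤ branch α ξ (lastChild α ξ) := Nat.sInf_mem hne
      constructor
      · rintro rfl
        exact Or.inl ⟨hmem, fun j hj => Nat.notMem_of_lt_sInf hj⟩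
      · rintro (⟨h1, h2⟩ | ⟨-, h2⟩)
        · refine le_antisymm (Nat.sInf_le h1) ?_
          by_contra hlt
          exact h2 _ (not_le.1 hlt) hmem
        · exact absurd hmem (h2 _)
  rw [this]
  refine ((hm i).inter (MeasurableSet.iInter fun j => MeasurableSet.iInter fun _ =>
    (hm j).compl)).union ?_
  by_cases hi : i = 0
  · simp only [hi, true_and]
    exact MeasurableSet.iInter fun j => (hm j).compl
  · simp [hi]

lemma measurable_lastChild_apply {E : Type*} [MeasurableSpace E] {g : ℕ → Marks → E}
    (hg : ∀ i, Measurable (g i)) : Measurable fun ξ => g (lastChild α ξ) ξ :=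
  (measurable_from_prod_countable_right (f := Function.uncurry g) hg).comp
    (measurable_lastChild.prodMk measurable_id)

lemma measurable_spine_apply {E : Type*} [MeasurableSpace E] (n : ℕ) {g : List ℕ → Marks → E}
    (hg : ∀ u, Measurable (g u)) : Measurable fun ξ => g (spine α ξ n) ξ := by
  induction n generalizing g with
  | zero => exact hg []
  | succ n ih =>
    refine ih (g := fun u ξ => g (lastChild α (subtree u ξ) :: u) ξ) fun u => ?_
    exact (measurable_from_prod_countable_right
      (f := Function.uncurry fun i ξ => g (i :: u) ξ) fun i => hg (i :: u)).comp
      ((measurable_lastChild.comp (measurable_subtree u)).prodMk measurable_id)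

/-- The value of `(Z 1, Θ 1, Δ 1)` if `Z 1 = z` and if the last block after the first split is the
`i`-th one. -/
def stepAt (ξ : Marks) (i : ℕ) (z : ℝ) : ℝ × ℝ × (ℕ → ℝ) :=
  (z, part ξ i, removeTerm (part ξ) i)

lemma firstStep_eq (ξ : Marks) : firstStep α ξ =
    stepAt ξ (lastChild α ξ) (lifetimeReal α (subtree [lastChild α ξ] ξ)) := rfl

lemma measurable_stepAt (i : ℕ) : Measurable fun p : Marks × ℝ => stepAt p.1 i p.2 := by
  refine measurable_snd.prodMk (Measurable.prodMk (by fun_prop) (measurable_pi_iff.2 fun j => ?_))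
  unfold removeTerm
  split_ifs <;> fun_prop

@[fun_prop]
lemma measurable_firstStep : Measurable (firstStep α) :=
  measurable_lastChild_apply (g := fun i ξ => stepAt ξ i (lifetimeReal α (subtree [i] ξ))) fun i =>
    (measurable_stepAt i).comp (by fun_prop : Measurable fun ξ : Marks =>
      (ξ, lifetimeReal α (subtree [i] ξ)))

@[fun_prop]
lemma measurable_subtree_lastChild : Measurable fun ξ => subtree [lastChild α ξ] ξ :=
  measurable_lastChild_apply (g := fun i ξ => subtree [i] ξ) fun i => measurable_subtree [i]

@[fun_prop]
lemma measurable_spineChain (n : ℕ) : Measurable (spineChain α n) := by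
  cases n with
  | zero => exact (measurable_lifetimeReal α).prodMk measurable_const
  | succ n =>
    exact measurable_spine_apply n (g := fun u ξ => firstStep α (subtree u ξ))
      fun u => by fun_prop

lemma Good.wins_iff (hα : α < 0) {ξ : Marks} (h : Good α ξ) (i : ℕ) :
    (∀ j, j ≠ i → branch α ξ j < branch α ξ i) ↔ i = lastChild α ξ := by
  constructor
  · intro hi
    by_contra hne
    have := hi _ (Ne.symm hne)
    rw [h.regular.branch_lastChild hα] at this
    exact this.not_ge (h.regular.branch_le i)
  · rintro rfl j hj
    rw [h.regular.branch_lastChild hα]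
    exact h.branch_lt hα hj

open Classical in
/-- Decomposition according to the rank of the sub-block that becomes extinct last. -/
lemma lintegral_lastChild (hα : α < 0) (hν : ν {s | (s : ℕ → ℝ) = Pi.single 0 1} = 0)
    {ψ : ℕ → Marks → Marks → ℝ≥0∞} (hψ : ∀ i, Measurable (Function.uncurry (ψ i)))
    (hdep : ∀ i ξ ξ' η, (∀ v, ¬ [i] <:+ v → ξ v = ξ' v) → ψ i ξ η = ψ i ξ' η) :
    ∫⁻ ξ, ψ (lastChild α ξ) ξ (subtree [lastChild α ξ] ξ) ∂marksLaw ν =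
      ∑' i, ∫⁻ ξ, ∫⁻ η, (if ∀ j, j ≠ i → branch α ξ j < part ξ i ^ (-α) * lifetimeReal α η then
        ψ i ξ η else 0) ∂marksLaw ν ∂marksLaw ν := by
  have hm (i : ℕ) : Measurable (Function.uncurry fun ξ η : Marks =>
      if ∀ j, j ≠ i → branch α ξ j < part ξ i ^ (-α) * lifetimeReal α η then
        ψ i ξ η else 0) := by
    refine Measurable.ite ?_ (hψ i) measurable_const
    simp only [Set.ofPred_forall]
    exact MeasurableSet.iInter fun j => MeasurableSet.iInter fun _ =>
      measurableSet_lt (by fun_prop) (by fun_prop)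
  have h1 : ∀ i, ∫⁻ ξ, ∫⁻ η, (if ∀ j, j ≠ i → branch α ξ j < part ξ i ^ (-α) * lifetimeReal α η then
        ψ i ξ η else 0) ∂marksLaw ν ∂marksLaw ν =
      ∫⁻ ξ, (if ∀ j, j ≠ i → branch α ξ j < branch α ξ i then
        ψ i ξ (subtree [i] ξ) else 0) ∂marksLaw ν := by
    intro i
    refine (lintegral_resample_subtree ν i (hm i) fun ξ ξ' η h => ?_).symm
    have hb : ∀ j, j ≠ i → branch α ξ j = branch α ξ' j := fun j hj => by
      rw [branch, branch, part_congr h, subtree_congr hj h]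
    have hiff : (∀ j, j ≠ i → branch α ξ j < part ξ i ^ (-α) * lifetimeReal α η) ↔
        ∀ j, j ≠ i → branch α ξ' j < part ξ' i ^ (-α) * lifetimeReal α η :=
      forall₂_congr fun j hj => by rw [hb j hj, part_congr h]
    simp only [hiff, hdep i ξ ξ' η h]
  simp_rw [h1]
  have hm' (i : ℕ) : Measurable fun ξ : Marks => if ∀ j, j ≠ i → branch α ξ j < branch α ξ i then
      ψ i ξ (subtree [i] ξ) else 0 :=
    (hm i).comp (by fun_prop : Measurable fun ξ : Marks => (ξ, subtree [i] ξ))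
  rw [← lintegral_tsum fun i => (hm' i).aemeasurable]
  refine lintegral_congr_ae ?_
  filter_upwards [ae_good hα hν] with ξ h
  simp only [h.wins_iff hα]
  -- For good marks exactly one rank wins, so a single term survives.
  rw [tsum_eq_single (lastChild α ξ) fun i hi => by simp [hi]]
  simp

variable (α ν) in
/-- The conditional law of the marks given that the extinction time is `x`, up to the clock of the
initial block. -/
def condKernel : Kernel ℝ Marks := tiltKernel (marksLaw ν) (residualReal α)

lemma isMarkovKernel_condKernel (hα : α < 0) (hν : ν {s | (s : ℕ → ℝ) = Pi.single 0 1} = 0) :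
    IsMarkovKernel (condKernel α ν) :=
  isMarkovKernel_tiltKernel (measurable_residualReal α) (tiltMass_residualReal_ne_zero hα hν)

/-- Disintegration with respect to the lifetime. It is restricted to functions blind to the clock of
the initial block, which `condKernel` does not adjust to x - R. -/
lemma lintegral_condKernel (hα : α < 0) (hν : ν {s | (s : ℕ → ℝ) = Pi.single 0 1} = 0)
    {φ : ℝ → Marks → ℝ≥0∞} (hφ : Measurable (Function.uncurry φ))
    (hφ0 : ∀ x ξ, φ x (setClock 0 ξ) = φ x ξ) :
    ∫⁻ ξ, φ (lifetimeReal α ξ) ξ ∂marksLaw ν =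
      ∫⁻ ξ, ∫⁻ η, φ (lifetimeReal α ξ) η ∂condKernel α ν (lifetimeReal α ξ) ∂marksLaw ν := by
  have := isMarkovKernel_condKernel (ν := ν) hα hν
  have hm : Measurable fun x => ∫⁻ η, φ x η ∂condKernel α ν x := hφ.lintegral_kernel_prod_right
  rw [lintegral_lifetimeReal_joint hα hν hφ hφ0,
    lintegral_exp_add_eq_tiltKernel (measurable_residualReal α) (residualReal_nonneg α)
      (tiltMass_residualReal_ne_zero hα hν) hφ, lintegral_lifetimeReal hα hν hm]
  rfl

lemma stepAt_congr {i : ℕ} {ξ ξ' : Marks} (h : ∀ v, ¬ [i] <:+ v → ξ v = ξ' v) (z : ℝ) :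
    stepAt ξ i z = stepAt ξ' i z := by
  rw [stepAt, stepAt, part_congr h]

/-- Given `(Z 1, Θ 1, Δ 1)`, the marks of the last sub-block are distributed as the marks of the
initial block given that the extinction time is `Z 1`. -/
lemma lintegral_firstStep (hα : α < 0) (hν : ν {s | (s : ℕ → ℝ) = Pi.single 0 1} = 0)
    {φ : ℝ × ℝ × (ℕ → ℝ) → Marks → ℝ≥0∞} (hφ : Measurable (Function.uncurry φ))
    (hφ0 : ∀ x ξ, φ x (setClock 0 ξ) = φ x ξ) :
    ∫⁻ ξ, φ (firstStep α ξ) (subtree [lastChild α ξ] ξ) ∂marksLaw ν =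
      ∫⁻ ξ, ∫⁻ η, φ (firstStep α ξ) η ∂condKernel α ν (firstStep α ξ).1 ∂marksLaw ν := by
  classical
  have := isMarkovKernel_condKernel (ν := ν) hα hν
  have hs (i : ℕ) : Measurable fun p : Marks × Marks => stepAt p.1 i (lifetimeReal α p.2) :=
    (measurable_stepAt i).comp (by fun_prop : Measurable fun p : Marks × Marks =>
      (p.1, lifetimeReal α p.2))
  have hk : Measurable fun y => ∫⁻ η, φ y η ∂condKernel α ν y.1 :=
    hφ.lintegral_kernel_prod_right (κ := (condKernel α ν).comap Prod.fst measurable_fst)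
  simp_rw [firstStep_eq]
  rw [lintegral_lastChild hα hν (ψ := fun i ξ η => φ (stepAt ξ i (lifetimeReal α η)) η)
      (fun i => hφ.comp ((hs i).prodMk measurable_snd))
      (fun i ξ ξ' η h => by simp only [stepAt_congr h]),
    lintegral_lastChild hα hν (ψ := fun i ξ η => ∫⁻ η', φ (stepAt ξ i (lifetimeReal α η)) η'
        ∂condKernel α ν (stepAt ξ i (lifetimeReal α η)).1)
      (fun i => hk.comp (hs i)) (fun i ξ ξ' η h => by simp only [stepAt_congr h])]
  refine tsum_congr fun i => lintegral_congr fun ξ => ?_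
  have hms : Measurable fun x : ℝ => stepAt ξ i x :=
    (measurable_stepAt i).comp (by fun_prop : Measurable fun x : ℝ => (ξ, x))
  -- With `i` and the other marks `ξ` fixed, both the winning condition and the first step depend on
  -- `η` only through its lifetime `x`, so disintegrating `η` leaves them untouched.
  rw [lintegral_condKernel hα hν (φ := fun x η =>
    if ∀ j, j ≠ i → branch α ξ j < part ξ i ^ (-α) * x then φ (stepAt ξ i x) η else 0)]
  · refine lintegral_congr fun η => ?_
    split_ifs
    · rfl
    · simp
  · refine Measurable.ite ?_ (hφ.comp ((hms.comp measurable_fst).prodMk measurable_snd))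
      measurable_const
    simp only [Set.ofPred_forall]
    exact MeasurableSet.iInter fun j => MeasurableSet.iInter fun _ =>
      measurableSet_lt (by fun_prop) (by fun_prop)
  · intro x η
    simp only [hφ0]

/-- The conditioning on `x` has a density that depends on R = Θ_1^(-α) Z_1 alone. A weight that is a
function of the first step can be absorbed into the test function of `lintegral_firstStep`. -/
lemma lintegral_condKernel_firstStep (hα : α < 0)
    (hν : ν {s | (s : ℕ → ℝ) = Pi.single 0 1} = 0) (x : ℝ)
    {φ : ℝ × ℝ × (ℕ → ℝ) → Marks → ℝ≥0∞} (hφ : Measurable (Function.uncurry φ))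
    (hφ0 : ∀ x ξ, φ x (setClock 0 ξ) = φ x ξ) :
    ∫⁻ ξ, φ (firstStep α ξ) (subtree [lastChild α ξ] ξ) ∂condKernel α ν x =
      ∫⁻ ξ, ∫⁻ η, φ (firstStep α ξ) η ∂condKernel α ν (firstStep α ξ).1 ∂condKernel α ν x := by
  have := isMarkovKernel_condKernel (ν := ν) hα hν
  have hG := measurable_residualReal α
  rcases le_or_gt x 0 with hx | hx
  -- For `x ≤ 0` the kernel is by convention the unconditioned law.
  · simpa only [condKernel, tiltKernel_of_nonpos hG hx] using lintegral_firstStep hα hν hφ hφ0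
  · set w : ℝ × ℝ × (ℕ → ℝ) → ℝ≥0∞ := tiltWeight (fun y => y.2.1 ^ (-α) * y.1) x with hw
    have hwm : Measurable w := (measurable_tiltWeight (by fun_prop)).of_uncurry_left
    have hwr : ∀ᵐ ξ ∂marksLaw ν, tiltWeight (residualReal α) x ξ = w (firstStep α ξ) := by
      filter_upwards [ae_good hα hν] with ξ h
      rw [hw, tiltWeight, tiltWeight, ← h.regular.branch_lastChild hα]
      rfl
    have hk : Measurable fun y => ∫⁻ η, φ y η ∂condKernel α ν y.1 :=
      hφ.lintegral_kernel_prod_right (κ := (condKernel α ν).comap Prod.fst measurable_fst)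
    have h1 : Measurable fun ξ => φ (firstStep α ξ) (subtree [lastChild α ξ] ξ) :=
      hφ.comp (measurable_firstStep.prodMk measurable_subtree_lastChild)
    have h2 : Measurable fun ξ => ∫⁻ η, φ (firstStep α ξ) η ∂condKernel α ν (firstStep α ξ).1 :=
      hk.comp measurable_firstStep
    conv_lhs => rw [condKernel, lintegral_tiltKernel hG hx h1]
    conv_rhs => enter [1]; rw [condKernel]
    rw [lintegral_tiltKernel hG hx h2]
    congr 1
    have e1 := lintegral_firstStep (ν := ν) hα hν (φ := fun y η => w y * φ y η)
      ((hwm.comp measurable_fst).mul hφ) (fun y η => by simp only [hφ0])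
    calc _ = ∫⁻ ξ, w (firstStep α ξ) * φ (firstStep α ξ) (subtree [lastChild α ξ] ξ)
          ∂marksLaw ν := by
          refine lintegral_congr_ae ?_
          filter_upwards [hwr] with ξ h; rw [h]
      _ = _ := by
          rw [e1]
          refine lintegral_congr_ae ?_
          filter_upwards [hwr] with ξ h
          rw [lintegral_const_mul _ hφ.of_uncurry_left, h]

/-- Append a value to a finite history. -/
def extendHistory {E : Type*} (n : ℕ) (w : Finset.Iic n → E) (y : E) : Finset.Iic (n + 1) → E :=
  fun m => if h : (m : ℕ) ≤ n then w ⟨m, Finset.mem_Iic.2 h⟩ else y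

lemma measurable_extendHistory {E : Type*} [MeasurableSpace E] (n : ℕ) :
    Measurable fun p : (Finset.Iic n → E) × E => extendHistory n p.1 p.2 := by
  refine measurable_pi_iff.2 fun m => ?_
  unfold extendHistory
  split_ifs <;> fun_prop

lemma extendHistory_eq {E : Type*} (n : ℕ) (X : ℕ → E) :
    extendHistory n (fun m => X m) (X (n + 1)) = fun m : Finset.Iic (n + 1) => X m := by
  ext m
  unfold extendHistory
  split_ifs with h
  · rfl
  · have : (m : ℕ) = n + 1 := le_antisymm (Finset.mem_Iic.1 m.2) (by omega)
    rw [this]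

/-- The history of the chain up to time `n`. -/
def history (α : ℝ) (n : ℕ) (ξ : Marks) : Finset.Iic n → ℝ × ℝ × (ℕ → ℝ) :=
  fun m => spineChain α m ξ

@[fun_prop]
lemma measurable_history (n : ℕ) : Measurable (history α n) :=
  measurable_pi_iff.2 fun m => measurable_spineChain m

lemma history_succ (n : ℕ) (ξ : Marks) : history α (n + 1) ξ =
    extendHistory n (history α n ξ) (firstStep α (subtree (spine α ξ n) ξ)) :=
  (extendHistory_eq n fun m => spineChain α m ξ).symm

/-- Given the history of the chain up to time `n`, the marks of the last block at time `T n` are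
distributed as the marks of the initial block given that the extinction time is `Z n`. -/
lemma lintegral_history (hα : α < 0) (hν : ν {s | (s : ℕ → ℝ) = Pi.single 0 1} = 0) (n : ℕ)
    {φ : (Finset.Iic n → ℝ × ℝ × (ℕ → ℝ)) → Marks → ℝ≥0∞} (hφ : Measurable (Function.uncurry φ))
    (hφ0 : ∀ w ξ, φ w (setClock 0 ξ) = φ w ξ) :
    ∫⁻ ξ, φ (history α n ξ) (subtree (spine α ξ n) ξ) ∂marksLaw ν =
      ∫⁻ ξ, ∫⁻ η, φ (history α n ξ) η ∂condKernel α ν (spineChain α n ξ).1 ∂marksLaw ν := by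
  have := isMarkovKernel_condKernel (ν := ν) hα hν
  induction n with
  | zero =>
    have h0 : ∀ ξ, history α 0 ξ = fun _ => (lifetimeReal α ξ, 1, 0) := by
      intro ξ
      ext1 m
      have : (m : ℕ) = 0 := Nat.le_zero.1 (Finset.mem_Iic.1 m.2)
      rw [history, this, spineChain]
    simp only [h0, spine, subtree_nil, spineChain]
    refine lintegral_condKernel hα hν (φ := fun x η => φ (fun _ => (x, 1, 0)) η) ?_
      (fun x ξ => hφ0 _ _)
    exact hφ.comp (by fun_prop : Measurable fun p : ℝ × Marks =>
      ((fun _ => (p.1, 1, 0) : Finset.Iic 0 → ℝ × ℝ × (ℕ → ℝ)), p.2))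
  | succ n ih =>
    have hext : Measurable fun p : (Finset.Iic n → ℝ × ℝ × (ℕ → ℝ)) × Marks =>
        extendHistory n p.1 (firstStep α p.2) :=
      (measurable_extendHistory n).comp (by fun_prop :
        Measurable fun p : (Finset.Iic n → ℝ × ℝ × (ℕ → ℝ)) × Marks => (p.1, firstStep α p.2))
    have hk : Measurable fun p : (Finset.Iic (n + 1) → ℝ × ℝ × (ℕ → ℝ)) × ℝ =>
        ∫⁻ η, φ p.1 η ∂condKernel α ν p.2 :=
      Measurable.lintegral_kernel_prod_right
        (κ := (condKernel α ν).comap Prod.snd measurable_snd)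
        (f := fun (p : (Finset.Iic (n + 1) → ℝ × ℝ × (ℕ → ℝ)) × ℝ) η => φ p.1 η)
        (hφ.comp (by fun_prop :
          Measurable fun p : ((Finset.Iic (n + 1) → ℝ × ℝ × (ℕ → ℝ)) × ℝ) × Marks =>
            (p.1.1, p.2)))
    simp_rw [history_succ, spine_succ, subtree_cons _ (spine α _ n)]
    -- The induction hypothesis replaces the marks below the `n`-th spine block by a conditioned
    -- tree; neither the first step nor the child subtrees see its initial clock.
    rw [ih (φ := fun w η => φ (extendHistory n w (firstStep α η)) (subtree [lastChild α η] η))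
      (hφ.comp (hext.prodMk ((measurable_subtree_lastChild (α := α)).comp measurable_snd)))
      (fun w η => by simp [firstStep_setClock, lastChild_setClock])]
    have h1 : ∀ ξ, ∫⁻ η, φ (extendHistory n (history α n ξ) (firstStep α η))
          (subtree [lastChild α η] η) ∂condKernel α ν (spineChain α n ξ).1 =
        ∫⁻ η, ∫⁻ η', φ (extendHistory n (history α n ξ) (firstStep α η)) η'
          ∂condKernel α ν (firstStep α η).1 ∂condKernel α ν (spineChain α n ξ).1 := by
      intro ξ
      refine lintegral_condKernel_firstStep hα hν _
        (φ := fun y η => φ (extendHistory n (history α n ξ) y) η) ?_ (fun y η => hφ0 _ _)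
      refine hφ.comp (Measurable.prodMk ?_ measurable_snd)
      exact (measurable_extendHistory n).comp ((measurable_const (a := history α n ξ)).prodMk
        (measurable_fst (α := ℝ × ℝ × (ℕ → ℝ)) (β := Marks)))
    simp_rw [h1]
    -- Once the child subtree has been resampled, the same identity is read backwards to restore the
    -- original marks.
    rw [← ih (φ := fun w η => ∫⁻ η', φ (extendHistory n w (firstStep α η)) η'
          ∂condKernel α ν (firstStep α η).1)
      (hk.comp (hext.prodMk (measurable_fst.comp (measurable_firstStep.comp measurable_snd))))
      (fun w η => by simp [firstStep_setClock])]
    rfl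

variable (α ν) in
/-- The law of the next triple as a function of the current value of `Z`. -/
def stepKernel : Kernel ℝ (ℝ × ℝ × (ℕ → ℝ)) := (condKernel α ν).map (firstStep α)

lemma isMarkovKernel_stepKernel (hα : α < 0) (hν : ν {s | (s : ℕ → ℝ) = Pi.single 0 1} = 0) :
    IsMarkovKernel (stepKernel α ν) := by
  have := isMarkovKernel_condKernel (ν := ν) hα hν
  exact Kernel.IsMarkovKernel.map _ measurable_firstStep

/-- The next triple is the first step of the subtree at the `n`-th spine block, so the joint law
with the history is an instance of `lintegral_history`. -/
lemma isMarkovChain_spineChain (hα : α < 0) (hν : ν {s | (s : ℕ → ℝ) = Pi.single 0 1} = 0) :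
    IsMarkovChain (spineChain α) ((stepKernel α ν).comap Prod.fst measurable_fst)
      (marksLaw ν) := by
  have := isMarkovKernel_condKernel (ν := ν) hα hν
  have := isMarkovKernel_stepKernel (ν := ν) hα hν
  intro n
  have hmp : Measurable fun ξ : Marks => (history α n ξ, spineChain α (n + 1) ξ) := by fun_prop
  refine ⟨hmp.aemeasurable, Measure.ext_of_lintegral _ fun g hg => ?_⟩
  rw [lintegral_map hg (by exact hmp), Measure.lintegral_compProd hg,
    lintegral_map (by exact hg.lintegral_kernel_prod_right') (by exact measurable_history n)]
  refine (lintegral_history hα hν n (φ := fun w η => g (w, firstStep α η))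
    (hg.comp (by fun_prop : Measurable fun p : (Finset.Iic n → ℝ × ℝ × (ℕ → ℝ)) × Marks =>
      (p.1, firstStep α p.2))) fun w η => by rw [firstStep_setClock]).trans ?_
  refine lintegral_congr fun ξ => ?_
  rw [Kernel.comap_apply, Kernel.comap_apply, stepKernel, Kernel.map_apply _ measurable_firstStep,
    lintegral_map (by fun_prop) measurable_firstStep]
  rfl

end

/-! ### The transition density. -/

section

variable {α : ℝ} {ν : Measure massPartitions} [IsProbabilityMeasure ν]

variable (α) in
/-- The relation between the relative masses `s`, the marks `ξ` and `y` that, after the first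
split, the `i`-th sub-block becomes extinct last if its extinction takes the time `y`. -/
def winSet (i : ℕ) : Set (massPartitions × Marks × ℝ) :=
  {p | ∀ j, j ≠ i → (p.1 : ℕ → ℝ) j ^ (-α) * lifetimeReal α (subtree [j] p.2.1) <
    (p.1 : ℕ → ℝ) i ^ (-α) * p.2.2}

lemma measurableSet_winSet (i : ℕ) : MeasurableSet (winSet α i) := by
  have hc (j : ℕ) : Measurable fun p : massPartitions × Marks × ℝ => (p.1 : ℕ → ℝ) j ^ (-α) :=
    ((measurable_massPartitions_apply j).comp measurable_fst).pow_const _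
  simp only [winSet, Set.ofPred_forall]
  exact MeasurableSet.iInter fun j => MeasurableSet.iInter fun _ =>
    measurableSet_lt ((hc j).mul (by fun_prop)) ((hc i).mul (by fun_prop))

open Classical in
variable (α) in
/-- The weight of the configurations in which the `i`-th sub-block becomes extinct last. -/
def winWeight (x : ℝ) (i : ℕ) (s : massPartitions) (ξ : Marks) (y : ℝ) : ℝ≥0∞ :=
  if (s, ξ, y) ∈ winSet α i then tiltWeight (fun g : ℝ => g) x ((s : ℕ → ℝ) i ^ (-α) * y) else 0

lemma measurable_winWeight (x : ℝ) (i : ℕ) :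
    Measurable fun p : massPartitions × Marks × ℝ => winWeight α x i p.1 p.2.1 p.2.2 := by
  refine Measurable.ite (measurableSet_winSet i) ?_ measurable_const
  refine (measurable_tiltWeight (G := fun g : ℝ => g) measurable_id).of_uncurry_left.comp ?_
  exact (((measurable_massPartitions_apply i).comp measurable_fst).pow_const _).mul (by fun_prop)

lemma winWeight_update_root (x : ℝ) (i : ℕ) (s : massPartitions) (ξ : Marks) (y : ℝ)
    (a : ℝ × massPartitions) :
    winWeight α x i s (Function.update ξ [] a) y = winWeight α x i s ξ y := by
  have h (j : ℕ) : subtree [j] (Function.update ξ [] a) = subtree [j] ξ :=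
    subtree_update_root j ξ a
  have hiff : (s, Function.update ξ [] a, y) ∈ winSet α i ↔ (s, ξ, y) ∈ winSet α i := by
    simp only [winSet, Set.mem_ofPred_eq, h]
  by_cases hmem : (s, ξ, y) ∈ winSet α i
  · rw [winWeight, winWeight, if_pos hmem, if_pos (hiff.2 hmem)]
  · rw [winWeight, winWeight, if_neg hmem, if_neg (hiff.not.2 hmem)]

lemma winWeight_zero {x : ℝ} {i : ℕ} {s : massPartitions} (hα : α < 0) (hs : (s : ℕ → ℝ) i = 0)
    (ξ : Marks) (y : ℝ) : winWeight α x i s ξ y = 0 := by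
  refine if_neg fun h => ?_
  have := h (i + 1) (by omega)
  simp only [hs, Real.zero_rpow (by linarith : -α ≠ 0), zero_mul] at this
  exact this.not_ge (mul_nonneg (Real.rpow_nonneg (s.2.2.1 _) _) (lifetimeReal_nonneg α _))

lemma rpow_neg_mul_lt_iff {a x y : ℝ} (ha : 0 < a) : a ^ (-α) * y < x ↔ y < a ^ α * x := by
  have hm : 0 < a ^ α := Real.rpow_pos_of_pos ha _
  rw [Real.rpow_neg ha.le, inv_mul_lt_iff₀ hm]

variable (α ν) in
/-- The distribution function of the extinction time. -/
def lifetimeCdf (x : ℝ) : ℝ := (marksLaw ν).real {ξ | lifetimeReal α ξ ≤ x}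

lemma measureReal_lifetimeReal_lt (hα : α < 0) (hν : ν {s | (s : ℕ → ℝ) = Pi.single 0 1} = 0)
    (x : ℝ) : (marksLaw ν).real {ξ | lifetimeReal α ξ < x} = lifetimeCdf α ν x := by
  refine measureReal_congr ?_
  have : ∀ᵐ ξ ∂marksLaw ν, lifetimeReal α ξ ≠ x := by
    rw [ae_iff]; simpa using measure_lifetimeReal_eq hα hν x
  filter_upwards [this] with ξ h
  exact propext ⟨fun h1 => le_of_lt h1, fun h1 => lt_of_le_of_ne h1 h⟩

-- For fixed `s` and `y`, winning is a separate constraint on each of the other subtrees, so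
-- independence gives an infinite product. Sub-blocks of mass 0 satisfy theirs trivially, which
-- explains the factor 1; strict inequalities become distribution functions since the lifetime is
-- diffuse.
open Classical in
lemma lintegral_winWeight (hα : α < 0) (hν : ν {s | (s : ℕ → ℝ) = Pi.single 0 1} = 0)
    (x : ℝ) (i : ℕ) (s : massPartitions) {y : ℝ} (hy : 0 < y) :
    ∫⁻ ξ, winWeight α x i s ξ y ∂marksLaw ν =
      if 0 < s.1 i ∧ 0 < y ∧ y < s.1 i ^ α * x then
        ENNReal.ofReal (Real.exp (s.1 i ^ (-α) * y) * ∏' j : ℕ, if j ≠ i ∧ 0 < s.1 j then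
          lifetimeCdf α ν (s.1 j ^ α * s.1 i ^ (-α) * y) else 1)
      else 0 := by
  rcases (s.2.2.1 i).eq_or_lt with hs | hs
  · rw [if_neg (by simp [← hs])]
    simp [winWeight_zero hα hs.symm]
  by_cases hyx : y < s.1 i ^ α * x
  swap
  · rw [if_neg fun h => hyx h.2.2]
    have : tiltWeight (fun g : ℝ => g) x (s.1 i ^ (-α) * y) = 0 :=
      if_neg ((rpow_neg_mul_lt_iff hs).not.2 hyx)
    simp [winWeight, this]
  have hw : tiltWeight (fun g : ℝ => g) x (s.1 i ^ (-α) * y) =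
      ENNReal.ofReal (Real.exp (s.1 i ^ (-α) * y)) := if_pos ((rpow_neg_mul_lt_iff hs).2 hyx)
  rw [if_pos ⟨hs, hy, hyx⟩]
  set C : ℕ → Set Marks := fun j =>
    {η | j ≠ i → s.1 j ^ (-α) * lifetimeReal α η < s.1 i ^ (-α) * y} with hC
  have hCm (j : ℕ) : MeasurableSet (C j) := by
    by_cases hj : j = i
    · simp [hC, hj]
    · simp only [hC, hj, ne_eq, not_false_eq_true, forall_const]
      exact measurableSet_lt (by fun_prop) measurable_const
  have hCr (j : ℕ) : (marksLaw ν).real (C j) = if j ≠ i ∧ 0 < s.1 j then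
      lifetimeCdf α ν (s.1 j ^ α * s.1 i ^ (-α) * y) else 1 := by
    by_cases hj : j = i
    · simp [hC, hj]
    rcases (s.2.2.1 j).eq_or_lt with hsj | hsj
    · have hpos : 0 < s.1 i ^ (-α) * y := mul_pos (Real.rpow_pos_of_pos hs _) hy
      have : C j = Set.univ := by
        ext η
        simp [hC, ← hsj, Real.zero_rpow (by linarith : -α ≠ 0), hpos]
      rw [this, if_neg (by simp [← hsj])]
      simp
    · rw [if_pos ⟨hj, hsj⟩, ← measureReal_lifetimeReal_lt hα hν]
      congr 1
      ext η
      simp only [hC, Set.mem_ofPred_eq]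
      rw [rpow_neg_mul_lt_iff hsj, mul_assoc]
      simp [hj]
  have hset : MeasurableSet {ξ | ∀ j, subtree [j] ξ ∈ C j} := by
    simp only [Set.ofPred_forall]
    exact MeasurableSet.iInter fun j => measurable_subtree [j] (hCm j)
  have hwin : ∀ ξ, winWeight α x i s ξ y = ENNReal.ofReal (Real.exp (s.1 i ^ (-α) * y)) *
      {ξ | ∀ j, subtree [j] ξ ∈ C j}.indicator 1 ξ := by
    intro ξ
    have hiff : ξ ∈ {ξ | ∀ j, subtree [j] ξ ∈ C j} ↔ (s, ξ, y) ∈ winSet α i := Iff.rfl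
    rw [winWeight, hw]
    by_cases h : (s, ξ, y) ∈ winSet α i
    · rw [if_pos h, Set.indicator_of_mem (hiff.2 h), Pi.one_apply, mul_one]
    · rw [if_neg h, Set.indicator_of_notMem (hiff.not.2 h), mul_zero]
  simp_rw [hwin]
  rw [lintegral_const_mul _ (measurable_one.indicator hset), lintegral_indicator_one hset,
    ENNReal.ofReal_mul (Real.exp_pos _).le]
  simp_rw [← hCr]
  rw [← measureReal_forall_subtree hCm, ofReal_measureReal]

/-- Split according to the winning rank `i`, integrate the lifetime of its subtree against the
density at `y`, then average over the masses and the other subtrees. -/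
lemma lintegral_firstStep_fst (hα : α < 0) (hν : ν {s | (s : ℕ → ℝ) = Pi.single 0 1} = 0)
    {x : ℝ} (hx : 0 < x) {φ : ℝ → ℝ≥0∞} (hφ : Measurable φ) :
    ∫⁻ ξ, φ (firstStep α ξ).1 ∂condKernel α ν x =
      (tiltMass (marksLaw ν) (residualReal α) x)⁻¹ *
        ∫⁻ y in Set.Ioi 0, ENNReal.ofReal (extinctionDensity α ν y) *
          (φ y * ∫⁻ s, ∑' i, ∫⁻ ξ, winWeight α x i s ξ y ∂marksLaw ν ∂ν) := by
  have htw : Measurable (tiltWeight (fun g : ℝ => g) x) :=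
    (measurable_tiltWeight measurable_id).of_uncurry_left
  rw [condKernel, lintegral_tiltKernel (measurable_residualReal α) hx (by fun_prop)]
  congr 1
  have h1 : ∫⁻ ξ, tiltWeight (residualReal α) x ξ * φ (firstStep α ξ).1 ∂marksLaw ν =
      ∫⁻ ξ, tiltWeight (fun g : ℝ => g) x (part ξ (lastChild α ξ) ^ (-α) *
        lifetimeReal α (subtree [lastChild α ξ] ξ)) *
          φ (lifetimeReal α (subtree [lastChild α ξ] ξ)) ∂marksLaw ν := by
    refine lintegral_congr_ae ?_
    filter_upwards [ae_good hα hν] with ξ h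
    have := h.regular.branch_lastChild hα
    rw [branch] at this
    rw [this]
    rfl
  rw [h1, lintegral_lastChild hα hν
    (ψ := fun i ξ η => tiltWeight (fun g : ℝ => g) x (part ξ i ^ (-α) * lifetimeReal α η) *
      φ (lifetimeReal α η))
    (fun i => (htw.comp (by fun_prop : Measurable fun p : Marks × Marks =>
      part p.1 i ^ (-α) * lifetimeReal α p.2)).mul (by fun_prop))
    (fun i ξ ξ' η h => by simp only [part_congr h])]
  have hroot (i : ℕ) : Measurable fun p : Marks × ℝ => winWeight α x i (p.1 []).2 p.1 p.2 :=
    (measurable_winWeight x i).comp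
      (by fun_prop : Measurable fun p : Marks × ℝ => ((p.1 []).2, p.1, p.2))
  have hsy (i : ℕ) : Measurable fun p : ℝ × massPartitions =>
      ∫⁻ ξ, winWeight α x i p.2 ξ p.1 ∂marksLaw ν := by
    refine Measurable.lintegral_prod_right'
      (f := fun q : (ℝ × massPartitions) × Marks => winWeight α x i q.1.2 q.2 q.1.1) ?_
    exact (measurable_winWeight x i).comp (by fun_prop :
      Measurable fun q : (ℝ × massPartitions) × Marks => (q.1.2, q.2, q.1.1))
  have hy (i : ℕ) : Measurable fun y => ∫⁻ s, ∫⁻ ξ, winWeight α x i s ξ y ∂marksLaw ν ∂ν :=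
    (hsy i).lintegral_prod_right'
  have hf : Measurable fun y => ENNReal.ofReal (extinctionDensity α ν y) :=
    measurable_extinctionDensity.ennreal_ofReal
  calc _ = ∑' i, ∫⁻ ξ, (∫⁻ y in Set.Ioi 0, ENNReal.ofReal (extinctionDensity α ν y) *
        (φ y * winWeight α x i (ξ []).2 ξ y)) ∂marksLaw ν := by
        refine tsum_congr fun i => lintegral_congr fun ξ => ?_
        have hmy : Measurable fun y => winWeight α x i (ξ []).2 ξ y :=
          (hroot i).comp (by fun_prop : Measurable fun y : ℝ => (ξ, y))
        rw [← lintegral_lifetimeReal hα hν (φ := fun y => φ y * winWeight α x i (ξ []).2 ξ y)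
          (hφ.mul hmy)]
        refine lintegral_congr fun η => ?_
        rw [winWeight, mul_ite, mul_zero, mul_comm (φ _)]
        rfl
    _ = ∑' i, ∫⁻ y in Set.Ioi 0, ENNReal.ofReal (extinctionDensity α ν y) *
        (φ y * ∫⁻ s, ∫⁻ ξ, winWeight α x i s ξ y ∂marksLaw ν ∂ν) := by
        refine tsum_congr fun i => ?_
        rw [lintegral_lintegral_swap]
        · refine lintegral_congr fun y => ?_
          have hmξ : Measurable fun ξ => winWeight α x i (ξ []).2 ξ y :=
            (hroot i).comp (by fun_prop : Measurable fun ξ : Marks => (ξ, y))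
          rw [lintegral_const_mul _ (hmξ.const_mul _), lintegral_const_mul _ hmξ,
            lintegral_part_subtree (φ := fun s ξ => winWeight α x i s ξ y)
              ((measurable_winWeight x i).comp (by fun_prop :
                Measurable fun p : massPartitions × Marks => (p.1, p.2, y)))
              (fun s ξ a => winWeight_update_root x i s ξ y a)]
        · exact ((hf.comp measurable_snd).mul
            ((hφ.comp measurable_snd).mul (hroot i))).aemeasurable
    _ = _ := by
        have hfy (i : ℕ) : Measurable fun y => ENNReal.ofReal (extinctionDensity α ν y) *
            (φ y * ∫⁻ s, ∫⁻ ξ, winWeight α x i s ξ y ∂marksLaw ν ∂ν) := hf.mul (hφ.mul (hy i))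
        rw [← lintegral_tsum fun i => (hfy i).aemeasurable]
        refine lintegral_congr fun y => ?_
        have hs (i : ℕ) : Measurable fun s => ∫⁻ ξ, winWeight α x i s ξ y ∂marksLaw ν :=
          (hsy i).comp (by fun_prop : Measurable fun s : massPartitions => (y, s))
        rw [ENNReal.tsum_mul_left, ENNReal.tsum_mul_left,
          lintegral_tsum fun i => (hs i).aemeasurable]

/-- The density at `x` is e^(-x) times the tilting mass, so the prefactor is the normalising
constant of the conditional law. -/
lemma ofReal_exp_div_mul (hα : α < 0) (hν : ν {s | (s : ℕ → ℝ) = Pi.single 0 1} = 0)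
    {x : ℝ} (hx : 0 < x) (y : ℝ) :
    ENNReal.ofReal (Real.exp (-x) / extinctionDensity α ν x * extinctionDensity α ν y) =
      (tiltMass (marksLaw ν) (residualReal α) x)⁻¹ * ENNReal.ofReal (extinctionDensity α ν y) := by
  have h0 := tiltMass_residualReal_ne_zero (ν := ν) hα hν x hx
  have htop : tiltMass (marksLaw ν) (residualReal α) x ≠ ∞ :=
    ne_top_of_le_ne_top ENNReal.ofReal_ne_top (tiltMass_le x)
  have h1 : Real.exp (-x) / extinctionDensity α ν x =
      ((tiltMass (marksLaw ν) (residualReal α) x)⁻¹).toReal := by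
    rw [extinctionDensity, tiltDensity, ENNReal.toReal_inv,
      div_mul_cancel_left₀ (Real.exp_ne_zero _)]
  rw [h1, ENNReal.ofReal_mul ENNReal.toReal_nonneg, ENNReal.ofReal_toReal (ENNReal.inv_ne_top.2 h0)]

lemma fst_stepKernel (hα : α < 0) (hν : ν {s | (s : ℕ → ℝ) = Pi.single 0 1} = 0)
    {x : ℝ} (hx : 0 < x) : (stepKernel α ν).fst x = volume.withDensity
      (transitionDensity α ν (extinctionDensity α ν) (lifetimeCdf α ν) x) := by
  set g : ℝ → ℝ≥0∞ := fun y => (tiltMass (marksLaw ν) (residualReal α) x)⁻¹ *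
    (ENNReal.ofReal (extinctionDensity α ν y) *
      ∫⁻ s, ∑' i, ∫⁻ ξ, winWeight α x i s ξ y ∂marksLaw ν ∂ν) with hg
  have hgm : Measurable g := by
    have hsy : Measurable fun p : ℝ × massPartitions =>
        ∑' i, ∫⁻ ξ, winWeight α x i p.2 ξ p.1 ∂marksLaw ν := by
      refine Measurable.tsum fun i => Measurable.lintegral_prod_right'
        (f := fun q : (ℝ × massPartitions) × Marks => winWeight α x i q.1.2 q.2 q.1.1) ?_
      exact (measurable_winWeight x i).comp (by fun_prop :
        Measurable fun q : (ℝ × massPartitions) × Marks => (q.1.2, q.2, q.1.1))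
    exact (measurable_extinctionDensity.ennreal_ofReal.mul hsy.lintegral_prod_right').const_mul _
  have htd : transitionDensity α ν (extinctionDensity α ν) (lifetimeCdf α ν) x =
      (Set.Ioi 0).indicator g := by
    ext y
    rw [transitionDensity]
    by_cases hy : 0 < y
    · rw [Set.indicator_of_mem (Set.mem_Ioi.2 hy), ofReal_exp_div_mul hα hν hx, hg, mul_assoc]
      simp only [lintegral_winWeight hα hν x _ _ hy]
    · rw [Set.indicator_of_notMem (by simpa using hy)]
      simp [hy]
  rw [htd]
  refine Measure.ext_of_lintegral _ fun φ hφ => ?_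
  rw [lintegral_withDensity_eq_lintegral_mul _ (hgm.indicator measurableSet_Ioi) hφ,
    Kernel.fst_apply, lintegral_map hφ measurable_fst, stepKernel,
    Kernel.map_apply _ measurable_firstStep, lintegral_map (by fun_prop) measurable_firstStep,
    lintegral_firstStep_fst hα hν hx hφ, ← lintegral_const_mul' _ _
      (ENNReal.inv_ne_top.2 (tiltMass_residualReal_ne_zero hα hν x hx)),
    ← lintegral_indicator measurableSet_Ioi]
  refine lintegral_congr fun y => ?_
  simp only [Pi.mul_apply, Set.indicator, hg]
  split_ifs
  · ring
  · simp

/-! ### Transfer of the Markov property to other spaces and to the first coordinate. -/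

section Transfer

variable {Ω Ω' E E' : Type*} [MeasurableSpace Ω] [MeasurableSpace Ω'] [MeasurableSpace E]
  [MeasurableSpace E'] {P : Measure Ω} {μ : Measure Ω'}

/-- The property only involves the laws of finite histories, so it survives pulling back and almost
sure modification. -/
lemma IsMarkovChain.comp_measurePreserving {Y : ℕ → Ω' → E} {κ : Kernel E E}
    (h : IsMarkovChain Y κ μ) (hY : ∀ n, Measurable (Y n)) {T : Ω → Ω'}
    (hT : MeasurePreserving T P μ) {X : ℕ → Ω → E} (hX : ∀ n, X n =ᵐ[P] Y n ∘ T) :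
    IsMarkovChain X κ P := by
  intro n
  have hW : (fun ω (m : Finset.Iic n) => X m ω) =ᵐ[P]
      (fun ω' (m : Finset.Iic n) => Y m ω') ∘ T := by
    filter_upwards [ae_all_iff.2 hX] with ω hω
    ext m; exact hω m
  have hYm : Measurable fun ω' (m : Finset.Iic n) => Y m ω' :=
    measurable_pi_iff.2 fun m => hY m
  have hpair : (fun ω => ((fun m : Finset.Iic n => X m ω), X (n + 1) ω)) =ᵐ[P]
      (fun ω' => ((fun m : Finset.Iic n => Y m ω'), Y (n + 1) ω')) ∘ T := by
    filter_upwards [hW, hX (n + 1)] with ω h1 h2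
    exact Prod.ext h1 h2
  have hpm : Measurable fun ω' => ((fun m : Finset.Iic n => Y m ω'), Y (n + 1) ω') :=
    hYm.prodMk (hY _)
  refine ⟨(hpm.comp hT.measurable).aemeasurable.congr hpair.symm, ?_⟩
  rw [Measure.map_congr hpair, Measure.map_congr hW, ← Measure.map_map hpm hT.measurable,
    ← Measure.map_map hYm hT.measurable, hT.map_eq]
  exact (h n).map_eq

/-- The kernel reads only the first coordinate of the current state, so the history can be projected
to first coordinates. -/
lemma IsMarkovChain.fst [IsProbabilityMeasure P] {X : ℕ → Ω → E × E'}
    {κ : Kernel E (E × E')} [IsMarkovKernel κ]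
    (h : IsMarkovChain X (κ.comap Prod.fst measurable_fst) P) :
    IsMarkovChain (fun n ω => (X n ω).1) κ.fst P := by
  intro n
  have hf : Measurable fun (w : Finset.Iic n → E × E') m => (w m).1 := by fun_prop
  exact HasCondDistrib.comp_right (hf := hf) (h n).fst

end Transfer

end

end Fragmentation

end

/-! ### Assembly: from the canonical tree to an arbitrary probability space. -/

theorem mainTheorem5 (α : ℝ) (hα : α < 0)
    (ν : Measure Fragmentation.massPartitions) [IsProbabilityMeasure ν]
    (hν : ν {s | (s : ℕ → ℝ) = Pi.single 0 1} = 0)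
    {Ω : Type*} [MeasurableSpace Ω] (P : Measure Ω) [IsProbabilityMeasure P]
    (ξ : List ℕ → Ω → ℝ × Fragmentation.massPartitions)
    (hξ_meas : ∀ u, Measurable (ξ u))
    (hξ_indep : iIndepFun ξ P)
    (hξ_law : ∀ u, P.map (ξ u) = (expMeasure 1).prod ν) :
    -- the process `(Z n, Θ n, Δ n)`, its component `Z` and the extinction time
    let X : ℕ → Ω → ℝ × ℝ × (ℕ → ℝ) := fun n ω => Fragmentation.chain α (fun u => ξ u ω) n
    let Z : ℕ → Ω → ℝ := fun n ω => Fragmentation.Z α (fun u => ξ u ω) n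
    let ζ : Ω → ℝ := fun ω => Fragmentation.extinctionTime α (fun u => ξ u ω)
    let Fζ : ℝ → ℝ := fun x => P.real {ω | ζ ω ≤ x}
    -- the continuous, strictly positive version of the density of `ζ` on `(0, ∞)`
    ∃ fζ : ℝ → ℝ, ContinuousOn fζ (Set.Ioi 0) ∧ (∀ x, 0 < x → 0 < fζ x) ∧
      HasLaw ζ ((volume.restrict (Set.Ioi 0)).withDensity fun x => ENNReal.ofReal (fζ x)) P ∧
      -- a kernel giving the law of the next triple as a function of the current value of `Z`
      ∃ κ : Kernel ℝ (ℝ × ℝ × (ℕ → ℝ)), IsMarkovKernel κ ∧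
        -- (a)
        Fragmentation.IsMarkovChain X (κ.comap Prod.fst measurable_fst) P ∧
        -- (b)
        (∀ n, ∀ᵐ ω ∂P, 0 < Z n ω) ∧
        Fragmentation.IsMarkovChain Z κ.fst P ∧
        ∀ x, 0 < x →
          κ.fst x = volume.withDensity (Fragmentation.transitionDensity α ν fζ Fζ x) := by
  intro X Z ζ Fζ
  set T : Ω → Fragmentation.Marks := fun ω u => ξ u ω with hTdef
  -- Independence and the common law say precisely that the whole family of marks has the product
  -- law.
  have hT : MeasurePreserving T P (Fragmentation.marksLaw ν) := by
    refine ⟨measurable_pi_iff.2 hξ_meas, ?_⟩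
    rw [hξ_indep.map_fun_eq_infinitePi_map hξ_meas]
    simp_rw [hξ_law]
    rfl
  have hgood : ∀ᵐ ω ∂P, Fragmentation.Good α (T ω) :=
    hT.quasiMeasurePreserving.ae (Fragmentation.ae_good hα hν)
  have hζ : ζ =ᵐ[P] Fragmentation.lifetimeReal α ∘ T := by
    filter_upwards [hgood] with ω h using h.extinctionTime_eq hα
  have hFζ : Fζ = Fragmentation.lifetimeCdf α ν := by
    ext x
    have hs : MeasurableSet {η | Fragmentation.lifetimeReal α η ≤ x} :=
      measurableSet_le (by fun_prop) measurable_const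
    rw [Fragmentation.lifetimeCdf, ← hT.measureReal_preimage hs.nullMeasurableSet]
    refine measureReal_congr ?_
    filter_upwards [hζ] with ω h
    exact propext (by change ζ ω ≤ x ↔ _; rw [h]; rfl)
  have hκ := Fragmentation.isMarkovKernel_stepKernel (ν := ν) hα hν
  have hX : Fragmentation.IsMarkovChain X
      ((Fragmentation.stepKernel α ν).comap Prod.fst measurable_fst) P := by
    refine (Fragmentation.isMarkovChain_spineChain hα hν).comp_measurePreserving
      (fun n => Fragmentation.measurable_spineChain n) hT fun n => ?_
    filter_upwards [hgood] with ω h using h.chain_eq hα n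
  refine ⟨Fragmentation.extinctionDensity α ν,
    Fragmentation.continuousOn_extinctionDensity hα hν,
    fun x hx => Fragmentation.extinctionDensity_pos hα hν hx, ?_,
    Fragmentation.stepKernel α ν, hκ, hX, fun n => ?_, hX.fst, fun x hx => ?_⟩
  · refine HasLaw.congr ⟨(by fun_prop : Measurable (Fragmentation.lifetimeReal α)).comp
      hT.measurable |>.aemeasurable, ?_⟩ hζ
    rw [← Measure.map_map (by fun_prop) hT.measurable, hT.map_eq,
      Fragmentation.map_lifetimeReal hα hν]
  · filter_upwards [hgood] with ω h
    change 0 < Fragmentation.Z α (T ω) n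
    rw [h.Z_eq hα]
    exact (h _).lifetimeReal_pos
  · rw [hFζ]
    exact Fragmentation.fst_stepKernel hα hν hx
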